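/- Let $n,d,d_1,d_2\ge 0$ be integers, and let $x_1,\dots,x_n$ be i.i.d. real random variables with $\mathbb E x_i=0$, $\mathbb E x_i^2=1$ and $|x_i|\le L$ almost surely. Let $\mathcal T^d_n\subseteq[n]^d$ be the set of $d$-tuples with pairwise distinct entries, and for every $\mathbf i\in\mathcal T^d_n$ let $\mathbf A_{\mathbf i}\in\mathbb R^{d_1\times d_2}$ be a deterministic matrix, such that $\mathbf A_{i_1,\dots,i_d}=\mathbf A_{i_{\sigma(1)},\dots,i_{\sigma(d)}}$ for every permutation $\sigma$ of $\{1,\dots,d\}$. Consider the permutation symmetric, homogeneous multilinear matrix polynomial $$\mathbf F(\mathbf x)=\sum_{\mathbf i\in\mathcal T^d_n}\mathbf A_{\mathbf i}\,x_{i_1}\cdots x_{i_d}.$$ Define block matrices of partial derivatives recursively by $\mathbf F_{0,0,0}=\mathbf F$ and $$\mathbf F_{a+1,b,c}=\begin{bmatrix}\partial_{x_1}\mathbf F_{a,b,c}\\ \vdots\\ \partial_{x_n}\mathbf F_{a,b,c}\end{bmatrix},\qquad \mathbf F_{a,b+1,c}=\begin{bmatrix}\partial_{x_1}\mathbf F_{a,b,c}&\cdots&\partial_{x_n}\mathbf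 F_{a,b,c}\end{bmatrix},\qquad \mathbf F_{a,b,c+1}=\begin{bmatrix}\partial_{x_1}\mathbf F_{a,b,c}&&\\&\ddots&\\&&\partial_{x_n}\mathbf F_{a,b,c}\end{bmatrix},$$ where for each $(a,b,c)$ the indices are raised from $(0,0,0)$ to $(a,b,c)$ in an arbitrary order. For $a+b+c=d$ the matrix $\mathbf F_{a,b,c}$ is deterministic. For a real matrix $\mathbf A$ and real $p\ge 2$ let $\|\mathbf A\|_p=\bigl(\operatorname{tr}(\mathbf A^{\mathsf T}\mathbf A)^{p/2}\bigr)^{1/p}$ be the Schatten norm. Then, whatever orders are chosen, for every real $t\ge 2$, $$\mathbb E\,\bigl\|\mathbf F(\mathbf x)-\mathbb E\,\mathbf F(\mathbf x)\bigr\|_{4t}^{4t}\;\le\;\sum_{\substack{a,b,c\in\mathbb Z_{\ge 0}\\ a+b+c=d}}(48dt)^{4dt}\,L^{4ct}\,\|\mathbf F_{a,b,c}\|_{4t}^{4t}$$ (with $0^0=1$ when $d=0$). -/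

import Mathlib

open MeasureTheory ProbabilityTheory

noncomputable section

namespace MatrixPoly

/-- The Schatten `p`-norm `‖A‖_p = (tr (Aᵀ A)^(p/2))^(1/p)` of a real matrix; the real power of the
positive semidefinite matrix `Aᵀ A` is taken by the functional calculus. -/
def schattenNorm {α β : Type*} [Fintype α] [Fintype β] [DecidableEq β]
    (p : ℝ) (A : Matrix α β ℝ) : ℝ :=
  (cfc (fun s : ℝ => s ^ (p / 2)) (A.transpose * A)).trace ^ (1 / p)

/-- A matrix whose entries are real polynomials in the variables `x_1, …, x_n`. -/
abbrev PolyMatrix (n : ℕ) (α β : Type*) := Matrix α β (MvPolynomial (Fin n) ℝ)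

/-- The value of a matrix polynomial at a point. -/
def evalAt {n : ℕ} {α β : Type*} (F : PolyMatrix n α β) (x : Fin n → ℝ) : Matrix α β ℝ :=
  F.map (MvPolynomial.eval x)

/-- The homogeneous multilinear matrix polynomial `F(x) = ∑ A_i x_{i_1} ⋯ x_{i_d}`, the sum running
over the `d`-tuples `i` of pairwise distinct elements of `[n]`, that is, over the injective maps
`Fin d ↪ Fin n`. -/
def multilinearPoly {n d : ℕ} {α β : Type*} (A : (Fin d ↪ Fin n) → Matrix α β ℝ) :
    PolyMatrix n α β :=
  Matrix.of fun r s =>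
    ∑ i : Fin d ↪ Fin n, MvPolynomial.C (A i r s) * ∏ k : Fin d, MvPolynomial.X (i k)

/-- Permutation symmetry: `A_{i_1, …, i_d} = A_{i_{σ(1)}, …, i_{σ(d)}}`. -/
def PermSymmetric {n d : ℕ} {α β : Type*} (A : (Fin d ↪ Fin n) → Matrix α β ℝ) : Prop :=
  ∀ (σ : Equiv.Perm (Fin d)) (i : Fin d ↪ Fin n), A (σ.toEmbedding.trans i) = A i

/-- The blocks `∂_{x_1} G, …, ∂_{x_n} G` stacked vertically. -/
def vertDeriv {n : ℕ} {α β : Type*} (G : PolyMatrix n α β) : PolyMatrix n (Fin n × α) β :=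
  Matrix.of fun r s => MvPolynomial.pderiv r.1 (G r.2 s)

/-- The blocks `∂_{x_1} G, …, ∂_{x_n} G` side by side. -/
def horizDeriv {n : ℕ} {α β : Type*} (G : PolyMatrix n α β) : PolyMatrix n α (Fin n × β) :=
  Matrix.of fun r s => MvPolynomial.pderiv s.1 (G r s.2)

/-- The block diagonal matrix with diagonal blocks `∂_{x_1} G, …, ∂_{x_n} G`. -/
def diagDeriv {n : ℕ} {α β : Type*} (G : PolyMatrix n α β) :
    PolyMatrix n (Fin n × α) (Fin n × β) :=
  Matrix.of fun r s => if r.1 = s.1 then MvPolynomial.pderiv r.1 (G r.2 s.2) else 0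

/-- An order in which the indices are raised one at a time from `(0, 0, 0)` to `(a, b, c)`. -/
inductive IncrementOrder : ℕ → ℕ → ℕ → Type
  | nil : IncrementOrder 0 0 0
  | vert {a b c : ℕ} (w : IncrementOrder a b c) : IncrementOrder (a + 1) b c
  | horiz {a b c : ℕ} (w : IncrementOrder a b c) : IncrementOrder a (b + 1) c
  | diag {a b c : ℕ} (w : IncrementOrder a b c) : IncrementOrder a b (c + 1)

namespace IncrementOrder

/-- The row index set of the block matrix: every vertical or diagonal step adds a factor `[n]`. -/
def Row (n : ℕ) (α : Type*) : {a b c : ℕ} → IncrementOrder a b c → Type _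
  | _, _, _, nil => α
  | _, _, _, vert w => Fin n × Row n α w
  | _, _, _, horiz w => Row n α w
  | _, _, _, diag w => Fin n × Row n α w

/-- The column index set: every horizontal or diagonal step adds a factor `[n]`. -/
def Col (n : ℕ) (β : Type*) : {a b c : ℕ} → IncrementOrder a b c → Type _
  | _, _, _, nil => β
  | _, _, _, vert w => Col n β w
  | _, _, _, horiz w => Fin n × Col n β w
  | _, _, _, diag w => Fin n × Col n β w

instance instFintypeRow (n : ℕ) (α : Type*) [Fintype α] :
    {a b c : ℕ} → (w : IncrementOrder a b c) → Fintype (Row n α w)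
  | _, _, _, nil => inferInstanceAs (Fintype α)
  | _, _, _, vert w =>
      letI := instFintypeRow n α w
      inferInstanceAs (Fintype (Fin n × Row n α w))
  | _, _, _, horiz w => instFintypeRow n α w
  | _, _, _, diag w =>
      letI := instFintypeRow n α w
      inferInstanceAs (Fintype (Fin n × Row n α w))

instance instFintypeCol (n : ℕ) (β : Type*) [Fintype β] :
    {a b c : ℕ} → (w : IncrementOrder a b c) → Fintype (Col n β w)
  | _, _, _, nil => inferInstanceAs (Fintype β)
  | _, _, _, vert w => instFintypeCol n β w
  | _, _, _, horiz w =>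
      letI := instFintypeCol n β w
      inferInstanceAs (Fintype (Fin n × Col n β w))
  | _, _, _, diag w =>
      letI := instFintypeCol n β w
      inferInstanceAs (Fintype (Fin n × Col n β w))

instance instDecidableEqCol (n : ℕ) (β : Type*) [DecidableEq β] :
    {a b c : ℕ} → (w : IncrementOrder a b c) → DecidableEq (Col n β w)
  | _, _, _, nil => inferInstanceAs (DecidableEq β)
  | _, _, _, vert w => instDecidableEqCol n β w
  | _, _, _, horiz w =>
      letI := instDecidableEqCol n β w
      inferInstanceAs (DecidableEq (Fin n × Col n β w))
  | _, _, _, diag w =>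
      letI := instDecidableEqCol n β w
      inferInstanceAs (DecidableEq (Fin n × Col n β w))

end IncrementOrder

/-- The block matrix `F_{a,b,c}` of all partial derivatives of order `a + b + c` of `F`, built
recursively from `F_{0,0,0} = F` by raising the indices in the order `w`. -/
def derivBlock {n : ℕ} {α β : Type*} (F : PolyMatrix n α β) :
    {a b c : ℕ} → (w : IncrementOrder a b c) → PolyMatrix n (w.Row n α) (w.Col n β)
  | _, _, _, .nil => F
  | _, _, _, .vert w => vertDeriv (derivBlock F w)
  | _, _, _, .horiz w => horizDeriv (derivBlock F w)
  | _, _, _, .diag w => diagDeriv (derivBlock F w)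

/-- The deterministic real matrix `F_{a,b,c}`: the matrix of constant terms of the polynomial matrix
`derivBlock F w`. If `F` is homogeneous of degree `a + b + c`, that matrix is constant,
see `derivBlock_eq_constBlock`. -/
def constBlock {n : ℕ} {α β : Type*} (F : PolyMatrix n α β) {a b c : ℕ}
    (w : IncrementOrder a b c) : Matrix (w.Row n α) (w.Col n β) ℝ :=
  (derivBlock F w).map MvPolynomial.constantCoeff

theorem multilinearPoly_isHomogeneous {n d : ℕ} {α β : Type*}
    (A : (Fin d ↪ Fin n) → Matrix α β ℝ) (r : α) (s : β) :
    (multilinearPoly A r s).IsHomogeneous d := by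
  unfold multilinearPoly
  refine MvPolynomial.IsHomogeneous.sum _ _ _ fun i _ => ?_
  have h := MvPolynomial.IsHomogeneous.prod (Finset.univ : Finset (Fin d))
    (fun k => (MvPolynomial.X (i k) : MvPolynomial (Fin n) ℝ)) (fun _ => 1)
    (fun k _ => MvPolynomial.isHomogeneous_X ℝ (i k))
  simpa using (MvPolynomial.isHomogeneous_C (Fin n) (A i r s)).mul h

theorem derivBlock_isHomogeneous {n : ℕ} {α β : Type*} (F : PolyMatrix n α β) {a b c : ℕ}
    (w : IncrementOrder a b c) :
    ∀ m : ℕ, (∀ r s, (F r s).IsHomogeneous (m + (a + b + c))) →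
      ∀ r s, (derivBlock F w r s).IsHomogeneous m := by
  induction w with
  | nil => intro m h r s; exact h r s
  | vert w ih =>
    intro m h r s
    exact (ih (m + 1) (fun r s => by convert h r s using 1; omega) r.2 s).pderiv
  | horiz w ih =>
    intro m h r s
    exact (ih (m + 1) (fun r s => by convert h r s using 1; omega) r s.2).pderiv
  | diag w ih =>
    intro m h r s
    have key := (ih (m + 1) (fun r s => by convert h r s using 1; omega) r.2 s.2).pderiv (i := r.1)
    change (if r.1 = s.1 then _ else (0 : MvPolynomial (Fin n) ℝ)).IsHomogeneous m
    split_ifs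
    · exact key
    · exact MvPolynomial.isHomogeneous_zero _ _ _

theorem derivBlock_eq_constBlock {n a b c : ℕ} {α β : Type*}
    (A : (Fin (a + b + c) ↪ Fin n) → Matrix α β ℝ) (w : IncrementOrder a b c) :
    derivBlock (multilinearPoly A) w
      = (constBlock (multilinearPoly A) w).map MvPolynomial.C := by
  ext1 r s
  have h := derivBlock_isHomogeneous (multilinearPoly A) w 0
    (fun r s => by simpa using multilinearPoly_isHomogeneous A r s) r s
  have h0 := MvPolynomial.totalDegree_eq_zero_iff_eq_C.mp
    (Nat.le_zero.mp h.totalDegree_le)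
  rw [h0]
  simp only [constBlock, Matrix.map_apply, MvPolynomial.constantCoeff_eq]

/-- The entrywise expectation of a random matrix. -/
def expectation {Ω α β : Type*} [MeasurableSpace Ω] (μ : Measure Ω) (M : Ω → Matrix α β ℝ) :
    Matrix α β ℝ :=
  Matrix.of fun r s => ∫ ω, M ω r s ∂μ

end MatrixPoly

end

/-! The argument is decoupling by colours followed by an iterated noncommutative Rosenthal
inequality. Put `r = 2 * t`, so that the quantity to bound is the mean of `schattenPow r`, the trace
of the `r`-th power of `Fᵀ F`.

Decoupling. Colour the variables by `d` colours and keep only the monomials whose variables have all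
`d` colours, one each. Every squarefree monomial of degree `d` survives for the same number of
colourings (`card_colourings`), so `F` is a constant, at most `d ^ d`, times the average of its
coloured parts (`sum_colourEval_multilinearPoly`). Convexity (`schattenPow_average_le`) reduces the
claim to a single coloured part, at the price `(d ^ d) ^ (2 * r)`.

Peeling. A coloured part is `∑ x_j B_j`, where `j` runs over the variables of the first colour and
each `B_j` is a derivative that involves later colours only. Conditionally on those, it is a sum of
independent centred matrices, and the Rosenthal inequality `integral_schattenPow_sum_smul_le` bounds
it by the blocks `B_j` stacked vertically, horizontally and diagonally, the last with weight `(L ^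
2) ^ r`. These are the three ways of raising an index, up to erasing rows and columns of wrong
colours, and erasing does not increase Schatten norms. After `d` steps only masked matrices
`F_{a,b,c}` remain. Each step costs at most `3 * (6 * r) ^ (2 * r)`. The order in which indices are
raised only permutes rows and columns, because partial derivatives commute
(`schattenPow_constBlock_eq`).

Rosenthal. Resampling one coordinate rewrites the mean of `tr |Z| ^ (2 * r)`, for `Z = ∑ x_i H_i`,
as a mean of products of differences. The mean value trace inequality `trace_sub_mul_cfc_sub_cfc_le`
bounds it by the mean of `tr (S + D) |Z| ^ (2 * r - 2)`, with `S = ∑ x_i ^ 2 H_i ^ 2` and `D = ∑ H_i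
^ 2`. Young's inequality absorbs `Z` into the left side. The same method applied to `S` leaves only
`D` and the individual `H_i`. -/

noncomputable section

namespace MatrixPoly

open Matrix

/-! ### Traces of functions of symmetric matrices -/

section Spectral

variable {α β ι : Type*} [Fintype α] [Fintype β] [Fintype ι] [DecidableEq α] [DecidableEq β]
  [DecidableEq ι]

/-- The right side sees only the characteristic polynomial, so identities for reindexed, block
diagonal and transposed products follow from identities of polynomials. -/
theorem trace_cfc_eq_sum_roots {A : Matrix ι ι ℝ} (hA : A.IsHermitian) (f : ℝ → ℝ) :
    (cfc f A).trace = (A.charpoly.roots.map f).sum := by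
  rw [hA.roots_charpoly_eq_eigenvalues, hA.cfc_eq, Matrix.IsHermitian.cfc,
    Unitary.conjStarAlgAut_apply, Matrix.trace_mul_cycle]
  simp [Matrix.trace_diagonal, Multiset.map_map, Function.comp_def, -Finset.sum_map_val]
  rfl

theorem trace_cfc_submatrix_equiv {A : Matrix α α ℝ} (hA : A.IsHermitian) (f : ℝ → ℝ)
    (e : β ≃ α) : (cfc f (A.submatrix e e)).trace = (cfc f A).trace := by
  rw [trace_cfc_eq_sum_roots hA, trace_cfc_eq_sum_roots (hA.submatrix e),
    ← Matrix.charpoly_reindex e.symm A]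
  rfl

theorem trace_cfc_fromBlocks {A : Matrix α α ℝ} {D : Matrix β β ℝ} (hA : A.IsHermitian)
    (hD : D.IsHermitian) (f : ℝ → ℝ) :
    (cfc f (fromBlocks A 0 0 D)).trace = (cfc f A).trace + (cfc f D).trace := by
  have h : (fromBlocks A 0 0 D).IsHermitian := Matrix.IsHermitian.fromBlocks hA (by simp) hD
  rw [trace_cfc_eq_sum_roots hA, trace_cfc_eq_sum_roots hD, trace_cfc_eq_sum_roots h,
    Matrix.charpoly_fromBlocks_zero₁₂, Polynomial.roots_mul, Multiset.map_add, Multiset.sum_add]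
  exact mul_ne_zero (Matrix.charpoly_monic _).ne_zero (Matrix.charpoly_monic _).ne_zero

theorem isHermitian_mul_transpose {α β : Type*} [Fintype β] (M : Matrix α β ℝ) : (M * Mᵀ).IsHermitian := by
  simpa using Matrix.isHermitian_mul_conjTranspose_self M

theorem isHermitian_transpose_mul {α β : Type*} [Fintype α] (M : Matrix α β ℝ) : (Mᵀ * M).IsHermitian := by
  simpa using Matrix.isHermitian_conjTranspose_mul_self M

/-- The two products have the same nonzero eigenvalues; the surplus zero eigenvalues of the larger
one contribute `f 0`. -/
theorem trace_cfc_mul_transpose (M : Matrix α β ℝ) {f : ℝ → ℝ} (hf : f 0 = 0) :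
    (cfc f (M * Mᵀ)).trace = (cfc f (Mᵀ * M)).trace := by
  rw [trace_cfc_eq_sum_roots (isHermitian_mul_transpose M),
    trace_cfc_eq_sum_roots (isHermitian_transpose_mul M)]
  have h := congrArg (fun P : Polynomial ℝ => (P.roots.map f).sum)
    (Matrix.charpoly_mul_comm' M Mᵀ)
  rw [Polynomial.roots_mul, Polynomial.roots_mul] at h
  · simpa [hf, Multiset.map_nsmul, Multiset.sum_nsmul] using h
  · exact mul_ne_zero (pow_ne_zero _ Polynomial.X_ne_zero) (Matrix.charpoly_monic _).ne_zero
  · exact mul_ne_zero (pow_ne_zero _ Polynomial.X_ne_zero) (Matrix.charpoly_monic _).ne_zero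

theorem charpoly_blockDiagonal (B : ι → Matrix α α ℝ) :
    (blockDiagonal B).charpoly = ∏ i, (B i).charpoly := by
  have h : (blockDiagonal B).charmatrix = blockDiagonal fun i => (B i).charmatrix := by
    ext ⟨a, i⟩ ⟨b, j⟩ : 1
    by_cases hij : i = j
    · subst hij
      by_cases hab : a = b
      · subst hab; simp [blockDiagonal_apply]
      · simp [blockDiagonal_apply, hab]
    · simp [blockDiagonal_apply, hij]
  rw [Matrix.charpoly, h, Matrix.det_blockDiagonal]
  rfl

theorem trace_cfc_blockDiagonal {B : ι → Matrix α α ℝ} (hB : ∀ i, (B i).IsHermitian)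
    (f : ℝ → ℝ) : (cfc f (blockDiagonal B)).trace = ∑ i, (cfc f (B i)).trace := by
  have h : (blockDiagonal B).IsHermitian := by
    rw [Matrix.IsHermitian, blockDiagonal_conjTranspose]
    exact congrArg _ (funext fun i => hB i)
  rw [trace_cfc_eq_sum_roots h, charpoly_blockDiagonal, Polynomial.roots_prod]
  · simp only [trace_cfc_eq_sum_roots (hB _), Multiset.map_bind, Multiset.sum_bind]
    rfl
  · exact Finset.prod_ne_zero_iff.mpr fun i _ => (Matrix.charpoly_monic _).ne_zero

/-- Joint diagonalisation of traces: for real symmetric `A` and `B` with eigenvalues `a j` and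
`b k`, the weights are the squared inner products of the eigenvectors. -/
theorem exists_trace_cfc_mul_cfc {A B : Matrix ι ι ℝ} (hA : A.IsHermitian) (hB : B.IsHermitian) :
    ∃ w : ι → ι → ℝ, (∀ j k, 0 ≤ w j k) ∧ ∀ f g : ℝ → ℝ,
      (cfc f A * cfc g B).trace
        = ∑ j, ∑ k, w j k * (f (hA.eigenvalues j) * g (hB.eigenvalues k)) := by
  set U : Matrix ι ι ℝ := hA.eigenvectorUnitary.1 with hU
  set V : Matrix ι ι ℝ := hB.eigenvectorUnitary.1 with hV
  refine ⟨fun j k => (star U * V) j k ^ 2, fun j k => sq_nonneg _, fun f g => ?_⟩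
  have h1 : cfc f A = U * diagonal (f ∘ hA.eigenvalues) * star U := by
    rw [hA.cfc_eq, Matrix.IsHermitian.cfc, Unitary.conjStarAlgAut_apply]; rfl
  have h2 : cfc g B = V * diagonal (g ∘ hB.eigenvalues) * star V := by
    rw [hB.cfc_eq, Matrix.IsHermitian.cfc, Unitary.conjStarAlgAut_apply]; rfl
  have h3 : (cfc f A * cfc g B).trace
      = (diagonal (f ∘ hA.eigenvalues) * (star U * V) *
        (diagonal (g ∘ hB.eigenvalues) * star (star U * V))).trace := by
    rw [h1, h2, Matrix.mul_assoc U, Matrix.mul_assoc U, Matrix.trace_mul_comm U]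
    simp only [star_mul, star_star, Matrix.mul_assoc]
  rw [h3, Matrix.trace]
  refine Finset.sum_congr rfl fun j _ => ?_
  rw [Matrix.diag_apply, Matrix.mul_apply]
  refine Finset.sum_congr rfl fun k _ => ?_
  rw [Matrix.diagonal_mul, Matrix.diagonal_mul, Matrix.star_apply]
  simp only [Function.comp, star_trivial]
  ring

end Spectral

/-! ### Continuity of the functional calculus and scalar inequalities -/

open scoped Matrix.Norms.L2Operator in
theorem continuous_cfc_comp {X ι : Type*} [TopologicalSpace X] [Fintype ι] [DecidableEq ι]
    {f : ℝ → ℝ} (hf : Continuous f) {A : X → Matrix ι ι ℝ} (hA : Continuous A)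
    (hA' : ∀ x, (A x).IsHermitian) : Continuous fun x => cfc f (A x) :=
  Continuous.cfc_of_mem_nhdsSet (s := Set.univ) f Filter.univ_mem hA hA' hf.continuousOn

theorem continuous_abs_rpow {q : ℝ} (hq : 0 ≤ q) : Continuous fun s : ℝ => |s| ^ q :=
  continuous_abs.rpow_const fun _ => Or.inr hq

theorem continuous_mul_abs_rpow {q : ℝ} (hq : 0 ≤ q) : Continuous fun s : ℝ => s * |s| ^ q :=
  continuous_id.mul (continuous_abs_rpow hq)

theorem rpow_sub_rpow_mul_le {x y q : ℝ} (hy : 0 ≤ y) (hxy : y ≤ x) (hq : 1 ≤ q) :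
    y * (x ^ q - y ^ q) ≤ q * x ^ q * (x - y) := by
  rcases hy.eq_or_lt with rfl | hy0
  · simp only [zero_mul, sub_zero]; positivity
  have hx : 0 < x := hy0.trans_le hxy
  have hb := one_add_mul_self_le_rpow_one_add (s := y / x - 1) (by
    have : 0 ≤ y / x := by positivity
    linarith) hq
  rw [add_sub_cancel, Real.div_rpow hy hx.le, le_div_iff₀ (by positivity)] at hb
  have h1 : x ^ q - y ^ q ≤ q * x ^ q * (1 - y / x) := by nlinarith
  calc y * (x ^ q - y ^ q) ≤ y * (q * x ^ q * (1 - y / x)) := by gcongr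
    _ ≤ x * (q * x ^ q * (1 - y / x)) := by
      have : 0 ≤ 1 - y / x := by rw [sub_nonneg, div_le_one hx]; exact hxy
      gcongr
    _ = q * x ^ q * (x - y) := by field_simp

/-- A mean value inequality for `s * |s| ^ q`. With `|b| ≤ |a|`, the difference splits as `(a - b) *
|a| ^ q + b * (|a| ^ q - |b| ^ q)`, and Bernoulli's inequality controls the second summand. -/
theorem sub_mul_abs_rpow_le {q : ℝ} (hq : 1 ≤ q) (a b : ℝ) :
    (a - b) * (a * |a| ^ q - b * |b| ^ q) ≤ (q + 1) * ((a - b) ^ 2 * (|a| ^ q + |b| ^ q)) := by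
  wlog h : |b| ≤ |a| generalizing a b
  · have := this b a (le_of_not_ge h)
    linarith
  have hA : 0 ≤ |a| ^ q := by positivity
  have hB : 0 ≤ |b| ^ q := by positivity
  have h1 := rpow_sub_rpow_mul_le (abs_nonneg b) h hq
  have hBA : |b| ^ q ≤ |a| ^ q := by gcongr
  have h2 : (a - b) * (b * (|a| ^ q - |b| ^ q)) ≤ |a - b| * (|b| * (|a| ^ q - |b| ^ q)) := by
    calc _ ≤ |(a - b) * (b * (|a| ^ q - |b| ^ q))| := le_abs_self _
      _ = _ := by rw [abs_mul, abs_mul, abs_of_nonneg (sub_nonneg.mpr hBA)]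
  have h3 : |a - b| * (|b| * (|a| ^ q - |b| ^ q)) ≤ |a - b| * (q * |a| ^ q * |a - b|) := by
    refine mul_le_mul_of_nonneg_left (h1.trans ?_) (abs_nonneg _)
    gcongr
    exact abs_sub_abs_le_abs_sub a b
  have h4 : |a - b| * (q * |a| ^ q * |a - b|) = q * |a| ^ q * (a - b) ^ 2 := by
    rw [← sq_abs (a - b)]; ring
  have h5 : 0 ≤ (q + 1) * (a - b) ^ 2 * |b| ^ q := by positivity
  nlinarith

/-- A crude Young inequality with a free parameter: the first term dominates when `h ≤ κ * d`, the
second otherwise. A large `κ` makes the `h` term small enough to be absorbed. -/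
theorem mul_rpow_sub_one_le {d h κ r : ℝ} (hd : 0 ≤ d) (hh : 0 ≤ h) (hκ : 0 < κ) (hr : 1 ≤ r) :
    d * h ^ (r - 1) ≤ κ ^ (r - 1) * d ^ r + κ⁻¹ * h ^ r := by
  have hadd : ∀ x : ℝ, 0 ≤ x → x * x ^ (r - 1) = x ^ r := fun x hx => by
    conv_lhs => rw [← Real.rpow_one x, ← Real.rpow_mul hx]
    rw [← Real.rpow_add_of_nonneg hx (by norm_num) (by linarith)]
    congr 1; ring
  have hr0 : 0 ≤ r - 1 := by linarith
  rcases le_total h (κ * d) with hle | hle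
  · have : d * h ^ (r - 1) ≤ d * (κ * d) ^ (r - 1) := by gcongr
    rw [Real.mul_rpow hκ.le hd] at this
    have h2 : 0 ≤ κ⁻¹ * h ^ r := by positivity
    have h3 := hadd d hd
    nlinarith [Real.rpow_nonneg hκ.le (r - 1)]
  · have h1 : d ≤ κ⁻¹ * h := by rw [inv_mul_eq_div, le_div_iff₀ hκ]; linarith
    have : d * h ^ (r - 1) ≤ (κ⁻¹ * h) * h ^ (r - 1) := by gcongr
    rw [mul_assoc, hadd h hh] at this
    have h2 : 0 ≤ κ ^ (r - 1) * d ^ r := by positivity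
    linarith

/-- The convex function `|s| ^ q` lies above its tangent at `a`; this is Bernoulli's inequality for
`|b| / |a|`. -/
theorem abs_rpow_add_mul_sub_le {q : ℝ} (hq : 2 ≤ q) (a b : ℝ) :
    |a| ^ q + q * (a * |a| ^ (q - 2)) * (b - a) ≤ |b| ^ q := by
  rcases eq_or_ne a 0 with rfl | ha
  · have : (0 : ℝ) ^ q = 0 := Real.zero_rpow (by linarith)
    simp [this]; positivity
  have hx : 0 < |a| := abs_pos.mpr ha
  have hb := one_add_mul_self_le_rpow_one_add (s := |b| / |a| - 1) (by
    have : 0 ≤ |b| / |a| := by positivity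
    linarith) (p := q) (by linarith)
  rw [add_sub_cancel, Real.div_rpow (abs_nonneg b) hx.le, le_div_iff₀ (by positivity)] at hb
  have h2 : |a| ^ q = |a| ^ (q - 2) * |a| ^ 2 := by
    rw [← Real.rpow_natCast |a| 2, ← Real.rpow_add hx]; norm_num
  have h3 : (1 + q * (|b| / |a| - 1)) * |a| ^ q
      = |a| ^ q + q * |a| ^ (q - 2) * (|a| * |b| - |a| ^ 2) := by
    rw [h2]; field_simp
  have h4 : a * b ≤ |a| * |b| := by rw [← abs_mul]; exact le_abs_self _
  have h5 : 0 ≤ q * |a| ^ (q - 2) := by positivity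
  have h6 := mul_le_mul_of_nonneg_left h4 h5
  rw [h3, sq_abs] at hb
  nlinarith

/-! ### Trace inequalities for two symmetric matrices -/

section Trace

variable {ι : Type*} [Fintype ι] [DecidableEq ι]

theorem trace_cfc_le_of_forall {A : Matrix ι ι ℝ} (hA : A.IsHermitian) {f g : ℝ → ℝ}
    (h : ∀ s, f s ≤ g s) : (cfc f A).trace ≤ (cfc g A).trace := by
  have key : ∀ f : ℝ → ℝ, (cfc f A).trace = ∑ j, f (hA.eigenvalues j) := fun f => by
    rw [trace_cfc_eq_sum_roots hA, hA.roots_charpoly_eq_eigenvalues]; simp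
  rw [key, key]
  exact Finset.sum_le_sum fun j _ => h _

/-- Traces of products of functions of two symmetric matrices, evaluated simultaneously. -/
structure TracePair (A B : Matrix ι ι ℝ) where
  left : ι → ℝ
  right : ι → ℝ
  weight : ι → ι → ℝ
  weight_nonneg : ∀ j k, 0 ≤ weight j k
  left_nonneg : A.PosSemidef → ∀ j, 0 ≤ left j
  right_nonneg : B.PosSemidef → ∀ j, 0 ≤ right j
  trace_eq : ∀ f g : ℝ → ℝ,
    (cfc f A * cfc g B).trace = ∑ j, ∑ k, weight j k * (f (left j) * g (right k))

namespace TracePair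

variable {A B : Matrix ι ι ℝ}

theorem nonempty (hA : A.IsHermitian) (hB : B.IsHermitian) : Nonempty (TracePair A B) := by
  obtain ⟨w, hw, h⟩ := exists_trace_cfc_mul_cfc hA hB
  exact ⟨⟨_, _, w, hw, fun h => h.eigenvalues_nonneg, fun h => h.eigenvalues_nonneg, h⟩⟩

/-- The weighted sum over all pairs of eigenvalues. -/
def sum (P : TracePair A B) (φ : ℝ → ℝ → ℝ) : ℝ :=
  ∑ j, ∑ k, P.weight j k * φ (P.left j) (P.right k)

theorem sum_add (P : TracePair A B) (φ ψ : ℝ → ℝ → ℝ) :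
    P.sum (fun a b => φ a b + ψ a b) = P.sum φ + P.sum ψ := by
  simp only [sum, mul_add, Finset.sum_add_distrib]

theorem sum_sub (P : TracePair A B) (φ ψ : ℝ → ℝ → ℝ) :
    P.sum (fun a b => φ a b - ψ a b) = P.sum φ - P.sum ψ := by
  simp only [sum, mul_sub, Finset.sum_sub_distrib]

theorem sum_const_mul (P : TracePair A B) (c : ℝ) (φ : ℝ → ℝ → ℝ) :
    P.sum (fun a b => c * φ a b) = c * P.sum φ := by
  simp only [sum, Finset.mul_sum]
  exact Finset.sum_congr rfl fun _ _ => Finset.sum_congr rfl fun _ _ => by ring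

theorem sum_le_sum (P : TracePair A B) {φ ψ : ℝ → ℝ → ℝ}
    (h : ∀ j k, φ (P.left j) (P.right k) ≤ ψ (P.left j) (P.right k)) : P.sum φ ≤ P.sum ψ :=
  Finset.sum_le_sum fun j _ => Finset.sum_le_sum fun k _ =>
    mul_le_mul_of_nonneg_left (h j k) (P.weight_nonneg j k)

theorem trace_cfc_mul_cfc (P : TracePair A B) (f g : ℝ → ℝ) :
    (cfc f A * cfc g B).trace = P.sum fun a b => f a * g b := P.trace_eq f g

theorem trace_cfc_left (P : TracePair A B) (hB : B.IsHermitian) (f : ℝ → ℝ) :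
    (cfc f A).trace = P.sum fun a _ => f a := by
  have h := P.trace_cfc_mul_cfc f fun _ => 1
  rw [cfc_const_one ℝ B hB.isSelfAdjoint, mul_one] at h
  simpa using h

theorem trace_cfc_right (P : TracePair A B) (hA : A.IsHermitian) (f : ℝ → ℝ) :
    (cfc f B).trace = P.sum fun _ b => f b := by
  have h := P.trace_cfc_mul_cfc (fun _ => 1) f
  rw [cfc_const_one ℝ A hA.isSelfAdjoint, one_mul] at h
  simpa using h

theorem trace_mul_cfc (P : TracePair A B) (hA : A.IsHermitian) (f : ℝ → ℝ) :
    (A * cfc f B).trace = P.sum fun a b => a * f b := by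
  have h := P.trace_cfc_mul_cfc (fun s : ℝ => s) f
  rwa [cfc_id' ℝ A hA.isSelfAdjoint] at h

theorem trace_cfc_mul (P : TracePair A B) (hB : B.IsHermitian) (f : ℝ → ℝ) :
    (B * cfc f A).trace = P.sum fun a b => f a * b := by
  have h := P.trace_cfc_mul_cfc f fun s => s
  rwa [cfc_id' ℝ B hB.isSelfAdjoint, Matrix.trace_mul_comm] at h

end TracePair

theorem mul_cfc_eq {A : Matrix ι ι ℝ} (hA : A.IsHermitian) {f : ℝ → ℝ} (hf : Continuous f) :
    A * cfc f A = cfc (fun s : ℝ => s * f s) A := by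
  rw [cfc_mul (fun s => s) f A continuous_id.continuousOn hf.continuousOn, cfc_id' ℝ A hA.isSelfAdjoint]

theorem cfc_mul_eq {A : Matrix ι ι ℝ} (hA : A.IsHermitian) {f : ℝ → ℝ} (hf : Continuous f) :
    cfc f A * A = cfc (fun s : ℝ => s * f s) A := by
  simp_rw [mul_comm _ (f _)]
  rw [cfc_mul f (fun s => s) A hf.continuousOn continuous_id.continuousOn, cfc_id' ℝ A hA.isSelfAdjoint]

theorem mul_self_eq_cfc {A : Matrix ι ι ℝ} (hA : A.IsHermitian) :
    A * A = cfc (fun s : ℝ => s * s) A := by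
  rw [cfc_mul (fun s => s) (fun s => s) A continuous_id.continuousOn continuous_id.continuousOn,
    cfc_id' ℝ A hA.isSelfAdjoint]

/-- After expansion and cyclic rotation every trace has the form `tr f(A) g(B)`, so all become sums
over pairs of eigenvalues with the same nonnegative weights. The scalar inequality
`sub_mul_abs_rpow_le` then applies termwise although `A` and `B` need not commute. -/
theorem trace_sub_mul_cfc_sub_cfc_le {A B : Matrix ι ι ℝ} (hA : A.IsHermitian)
    (hB : B.IsHermitian) {q : ℝ} (hq : 1 ≤ q) :
    ((A - B) * (cfc (fun s : ℝ => s * |s| ^ q) A - cfc (fun s : ℝ => s * |s| ^ q) B)).trace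
      ≤ (q + 1) * (((A - B) * (A - B) * cfc (fun s : ℝ => |s| ^ q) A).trace
        + ((A - B) * (A - B) * cfc (fun s : ℝ => |s| ^ q) B).trace) := by
  obtain ⟨P⟩ := TracePair.nonempty hA hB
  have hq0 : 0 ≤ q := by linarith
  set f : ℝ → ℝ := fun s => s * |s| ^ q with hf
  set g : ℝ → ℝ := fun s => |s| ^ q with hg
  have cf : Continuous f := continuous_mul_abs_rpow hq0
  have cg : Continuous g := continuous_abs_rpow hq0
  have h1 : ((A - B) * (cfc f A - cfc f B)).trace
      = P.sum fun a b => (a - b) * (f a - f b) := by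
    have e : (A - B) * (cfc f A - cfc f B)
        = A * cfc f A - A * cfc f B - B * cfc f A + B * cfc f B := by noncomm_ring
    rw [e, trace_add, trace_sub, trace_sub, P.trace_mul_cfc hA, P.trace_cfc_mul hB,
      mul_cfc_eq hA cf, mul_cfc_eq hB cf, P.trace_cfc_left hB, P.trace_cfc_right hA,
      ← P.sum_sub, ← P.sum_sub, ← P.sum_add]
    congr 1; ext a b; ring
  have h2 : ((A - B) * (A - B) * cfc g A).trace = P.sum fun a b => (a - b) ^ 2 * g a := by
    have e : (A - B) * (A - B) * cfc g A
        = A * (A * cfc g A) - A * (B * cfc g A) - B * (A * cfc g A) + B * B * cfc g A := by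
      noncomm_ring
    rw [e, trace_add, trace_sub, trace_sub, Matrix.trace_mul_comm A (B * cfc g A), mul_assoc B,
      cfc_mul_eq hA cg, mul_cfc_eq hA cg, P.trace_cfc_mul hB, mul_cfc_eq hA (by fun_prop),
      P.trace_cfc_left hB, Matrix.trace_mul_comm (B * B), mul_self_eq_cfc hB,
      P.trace_cfc_mul_cfc, ← P.sum_sub, ← P.sum_sub, ← P.sum_add]
    congr 1; ext a b; ring
  have h3 : ((A - B) * (A - B) * cfc g B).trace = P.sum fun a b => (a - b) ^ 2 * g b := by
    have e : (A - B) * (A - B) * cfc g B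
        = A * A * cfc g B - A * (B * cfc g B) - B * (A * cfc g B) + B * (B * cfc g B) := by
      noncomm_ring
    rw [e, trace_add, trace_sub, trace_sub, Matrix.trace_mul_comm B (A * cfc g B), mul_assoc A (cfc g B) B,
      cfc_mul_eq hB cg, mul_cfc_eq hB cg, P.trace_mul_cfc hA, mul_cfc_eq hB (by fun_prop),
      P.trace_cfc_right hA, mul_self_eq_cfc hA,
      P.trace_cfc_mul_cfc, ← P.sum_sub, ← P.sum_sub, ← P.sum_add]
    congr 1; ext a b; ring
  rw [h1, h2, h3, ← P.sum_add, ← P.sum_const_mul]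
  refine P.sum_le_sum fun j k => ?_
  have := sub_mul_abs_rpow_le hq (P.left j) (P.right k)
  simp only [hf, hg]
  linarith

theorem trace_mul_cfc_abs_rpow_le {D H : Matrix ι ι ℝ} (hD : D.PosSemidef) (hH : H.IsHermitian)
    {κ r : ℝ} (m : ℝ) (hκ : 0 < κ) (hr : 1 ≤ r) :
    (D * cfc (fun s : ℝ => |s| ^ (m * (r - 1))) H).trace
      ≤ κ ^ (r - 1) * (cfc (fun s : ℝ => |s| ^ r) D).trace
        + κ⁻¹ * (cfc (fun s : ℝ => |s| ^ (m * r)) H).trace := by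
  obtain ⟨P⟩ := TracePair.nonempty hD.isHermitian hH
  rw [P.trace_mul_cfc hD.isHermitian, P.trace_cfc_left hH, P.trace_cfc_right hD.isHermitian,
    ← P.sum_const_mul, ← P.sum_const_mul, ← P.sum_add]
  refine P.sum_le_sum fun j k => ?_
  have hd := P.left_nonneg hD j
  rw [abs_of_nonneg hd, Real.rpow_mul (abs_nonneg _), Real.rpow_mul (abs_nonneg _)]
  exact mul_rpow_sub_one_le hd (by positivity) hκ hr

/-- Young's inequality for `c * y` and `|s|` with exponent `r - 1`, times one more factor `y`. In
this form `c` enters only the term with `Q` alone, and the other term keeps a factor `Q` that can be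
summed over the coordinates. -/
theorem mul_trace_mul_self_mul_cfc_abs_rpow_le {Q S : Matrix ι ι ℝ} (hQ : Q.PosSemidef)
    (hS : S.IsHermitian) {κ r c : ℝ} (hκ : 0 < κ) (hr : 2 ≤ r) (hc : 0 ≤ c) :
    c * (Q * Q * cfc (fun s : ℝ => |s| ^ (r - 2)) S).trace
      ≤ κ ^ (r - 2) * c ^ (r - 1) * (cfc (fun s : ℝ => |s| ^ r) Q).trace
        + κ⁻¹ * (Q * cfc (fun s : ℝ => |s| ^ (r - 1)) S).trace := by
  obtain ⟨P⟩ := TracePair.nonempty hQ.isHermitian hS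
  rw [mul_self_eq_cfc hQ.isHermitian, P.trace_cfc_mul_cfc, P.trace_cfc_left hS,
    P.trace_mul_cfc hQ.isHermitian, ← P.sum_const_mul, ← P.sum_const_mul, ← P.sum_const_mul,
    ← P.sum_add]
  refine P.sum_le_sum fun j k => ?_
  have hd := P.left_nonneg hQ j
  set y := P.left j
  set s := P.right k
  have h := mul_rpow_sub_one_le (d := c * y) (h := |s|) (κ := κ) (r := r - 1) (by positivity)
    (abs_nonneg s) hκ (by linarith)
  have e1 : r - 1 - 1 = r - 2 := by ring
  rw [e1, Real.mul_rpow hc hd] at h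
  have h2 := mul_le_mul_of_nonneg_left h hd
  have h3 : y * y ^ (r - 1) = |y| ^ r := by
    rw [abs_of_nonneg hd]
    conv_lhs => rw [← Real.rpow_one y, ← Real.rpow_mul hd]
    rw [← Real.rpow_add_of_nonneg hd (by norm_num) (by linarith)]
    congr 1; ring
  rw [← h3]
  linarith

/-- The tangent inequality under the trace. It yields both monotonicity in the semidefinite order
and convexity of Schatten powers. -/
theorem trace_cfc_abs_rpow_add_le {A B : Matrix ι ι ℝ} (hA : A.IsHermitian) (hB : B.IsHermitian)
    {q : ℝ} (hq : 2 ≤ q) :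
    (cfc (fun s : ℝ => |s| ^ q) A).trace
        + q * ((B - A) * cfc (fun s : ℝ => s * |s| ^ (q - 2)) A).trace
      ≤ (cfc (fun s : ℝ => |s| ^ q) B).trace := by
  obtain ⟨P⟩ := TracePair.nonempty hA hB
  rw [sub_mul, trace_sub, P.trace_cfc_mul hB,
    mul_cfc_eq hA (continuous_mul_abs_rpow (by linarith)), P.trace_cfc_left hB,
    P.trace_cfc_left hB, P.trace_cfc_right hA, ← P.sum_sub, ← P.sum_const_mul, ← P.sum_add]
  refine P.sum_le_sum fun j k => ?_
  have := abs_rpow_add_mul_sub_le hq (P.left j) (P.right k)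
  linarith

theorem trace_mul_cfc_nonneg {A B : Matrix ι ι ℝ} (hA : A.PosSemidef) (hB : B.PosSemidef)
    {f : ℝ → ℝ} (hf : ∀ s, 0 ≤ s → 0 ≤ f s) : 0 ≤ (A * cfc f B).trace := by
  obtain ⟨P⟩ := TracePair.nonempty hA.isHermitian hB.isHermitian
  rw [P.trace_mul_cfc hA.isHermitian]
  exact Finset.sum_nonneg fun j _ => Finset.sum_nonneg fun k _ =>
    mul_nonneg (P.weight_nonneg j k)
      (mul_nonneg (P.left_nonneg hA j) (hf _ (P.right_nonneg hB k)))

theorem trace_cfc_abs_rpow_mono {A B : Matrix ι ι ℝ} (hA : A.PosSemidef)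
    (hB : B.IsHermitian) (hAB : (B - A).PosSemidef) {q : ℝ} (hq : 2 ≤ q) :
    (cfc (fun s : ℝ => |s| ^ q) A).trace ≤ (cfc (fun s : ℝ => |s| ^ q) B).trace := by
  have h := trace_cfc_abs_rpow_add_le hA.isHermitian hB hq
  have h2 := trace_mul_cfc_nonneg hAB hA (f := fun s => s * |s| ^ (q - 2))
    fun s hs => by positivity
  have h3 : 0 ≤ q * ((B - A) * cfc (fun s : ℝ => s * |s| ^ (q - 2)) A).trace := by positivity
  linarith

theorem cfc_abs_rpow_nonneg_trace {A : Matrix ι ι ℝ} (hA : A.IsHermitian) (q : ℝ) :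
    0 ≤ (cfc (fun s : ℝ => |s| ^ q) A).trace := by
  have := trace_cfc_le_of_forall hA (f := fun _ => 0) (g := fun s => |s| ^ q)
    fun s => by positivity
  simpa [cfc_const_zero] using this

theorem cfc_congr_of_posSemidef {A : Matrix ι ι ℝ} (hA : A.PosSemidef) {f g : ℝ → ℝ}
    (h : ∀ s, 0 ≤ s → f s = g s) : cfc f A = cfc g A := by
  refine cfc_congr fun s hs => h s ?_
  rw [hA.isHermitian.spectrum_real_eq_range_eigenvalues] at hs
  obtain ⟨j, rfl⟩ := hs
  exact hA.eigenvalues_nonneg j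

theorem trace_cfc_abs_rpow_smul {A : Matrix ι ι ℝ} (hA : A.IsHermitian) (c q : ℝ) :
    (cfc (fun s : ℝ => |s| ^ q) (c • A)).trace = |c| ^ q * (cfc (fun s : ℝ => |s| ^ q) A).trace := by
  rw [← cfc_comp_smul c (fun s => |s| ^ q) A (by
      have : (spectrum ℝ A).Finite := Matrix.finite_real_spectrum
      exact (this.image _).continuousOn _) hA.isSelfAdjoint]
  simp only [smul_eq_mul, abs_mul, Real.mul_rpow (abs_nonneg _) (abs_nonneg _)]
  rw [cfc_const_mul _ _ A (by
      have : (spectrum ℝ A).Finite := Matrix.finite_real_spectrum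
      exact this.continuousOn _), trace_smul, smul_eq_mul]

end Trace

/-! ### Bounded product measures and resampling of one coordinate -/

theorem integrable_of_continuous_of_ae_mem {X : Type*} [TopologicalSpace X] [MeasurableSpace X]
    [OpensMeasurableSpace X] {μ : Measure X} [IsFiniteMeasure μ]
    {K : Set X} (hK : IsCompact K) (hμ : ∀ᵐ x ∂μ, x ∈ K) {g : X → ℝ} (hg : Continuous g) :
    Integrable g μ := by
  obtain ⟨C, hC⟩ := hK.exists_bound_of_continuousOn hg.continuousOn
  exact Integrable.of_bound hg.measurable.aestronglyMeasurable C (hμ.mono fun x hx => hC x hx)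

section Bounded

variable {ν : Measure ℝ} [IsProbabilityMeasure ν] {L : ℝ}

theorem integrable_of_continuous (hL : ∀ᵐ y ∂ν, |y| ≤ L) {g : ℝ → ℝ} (hg : Continuous g) :
    Integrable g ν :=
  integrable_of_continuous_of_ae_mem (isCompact_Icc (a := -L) (b := L))
    (hL.mono fun _ hy => abs_le.mp hy) hg

theorem integrable_prod_of_continuous (hL : ∀ᵐ y ∂ν, |y| ≤ L) {g : ℝ × ℝ → ℝ}
    (hg : Continuous g) : Integrable g (ν.prod ν) := by
  have h1 : ∀ᵐ p ∂(ν.prod ν), |p.1| ≤ L := Measure.quasiMeasurePreserving_fst.ae hL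
  have h2 : ∀ᵐ p ∂(ν.prod ν), |p.2| ≤ L := Measure.quasiMeasurePreserving_snd.ae hL
  refine integrable_of_continuous_of_ae_mem
    ((isCompact_Icc (a := -L) (b := L)).prod (isCompact_Icc (a := -L) (b := L))) ?_ hg
  filter_upwards [h1, h2] with p hp hp'
  exact ⟨abs_le.mp hp, abs_le.mp hp'⟩

variable {σ : Type*} [Fintype σ]

theorem ae_pi_abs_le (hL : ∀ᵐ y ∂ν, |y| ≤ L) :
    ∀ᵐ x ∂(Measure.pi fun _ : σ => ν), ∀ i, |x i| ≤ L :=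
  ae_all_iff.mpr fun i => (Measure.quasiMeasurePreserving_eval (μ := fun _ : σ => ν) i).ae hL

theorem integrable_pi_of_continuous (hL : ∀ᵐ y ∂ν, |y| ≤ L) {g : (σ → ℝ) → ℝ}
    (hg : Continuous g) : Integrable g (Measure.pi fun _ : σ => ν) := by
  refine integrable_of_continuous_of_ae_mem
    (isCompact_univ_pi fun _ : σ => isCompact_Icc (a := -L) (b := L)) ?_ hg
  filter_upwards [ae_pi_abs_le hL] with x hx i _
  exact abs_le.mp (hx i)

variable [DecidableEq σ]

theorem measurePreserving_update (i : σ) :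
    MeasurePreserving (fun p : (σ → ℝ) × ℝ => Function.update p.1 i p.2)
      ((Measure.pi fun _ : σ => ν).prod ν) (Measure.pi fun _ : σ => ν) := by
  have hm : Measurable fun p : (σ → ℝ) × ℝ => Function.update p.1 i p.2 := by
    refine measurable_pi_lambda _ fun j => ?_
    rcases eq_or_ne j i with rfl | hj
    · simpa using measurable_snd
    · simpa [hj, Function.comp_def] using (measurable_pi_apply j).comp measurable_fst
  refine ⟨hm, (Measure.pi_eq fun s hs => ?_).symm⟩
  rw [Measure.map_apply hm (MeasurableSet.univ_pi hs)]
  have : (fun p : (σ → ℝ) × ℝ => Function.update p.1 i p.2) ⁻¹' (Set.univ.pi s)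
      = (Set.univ.pi (Function.update s i Set.univ)) ×ˢ s i := by
    ext ⟨x, y⟩
    simp only [Set.mem_preimage, Set.mem_pi, Set.mem_univ, true_implies, Set.mem_prod]
    constructor
    · intro h
      refine ⟨fun j => ?_, by simpa using h i⟩
      rcases eq_or_ne j i with rfl | hj
      · simp
      · simpa [hj] using h j
    · rintro ⟨h, h'⟩ j
      rcases eq_or_ne j i with rfl | hj
      · simpa using h'
      · simpa [hj] using h j
  -- The overwritten coordinate contributes a factor of total mass one, and the fresh one supplies
  -- `ν (s i)`.
  rw [this, Measure.prod_prod, Measure.pi_pi, ← Finset.prod_erase_mul _ _ (Finset.mem_univ i),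
    ← Finset.prod_erase_mul (a := i) _ (fun j => ν (s j)) (Finset.mem_univ i)]
  simp only [Function.update_self, measure_univ, mul_one]
  congr 1
  refine Finset.prod_congr rfl fun j hj => ?_
  rw [Function.update_of_ne (Finset.ne_of_mem_erase hj)]

theorem integral_pi_eq_integral_update (hL : ∀ᵐ y ∂ν, |y| ≤ L) (i : σ) {g : (σ → ℝ) → ℝ}
    (hg : Continuous g) :
    ∫ x, g x ∂(Measure.pi fun _ : σ => ν)
      = ∫ x, ∫ y, g (Function.update x i y) ∂ν ∂(Measure.pi fun _ : σ => ν) := by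
  have h := measurePreserving_update (ν := ν) i
  conv_lhs => rw [← h.map_eq]
  rw [integral_map h.measurable.aemeasurable hg.measurable.aestronglyMeasurable]
  refine integral_prod _ ?_
  exact (h.integrable_comp hg.measurable.aestronglyMeasurable).mpr
    (integrable_pi_of_continuous hL hg)

theorem integral_pi_mono_update (hL : ∀ᵐ y ∂ν, |y| ≤ L) (i : σ) {g h : (σ → ℝ) → ℝ}
    (hg : Continuous g) (hh : Continuous h)
    (hgh : ∀ x, ∫ y, g (Function.update x i y) ∂ν ≤ ∫ y, h (Function.update x i y) ∂ν) :
    ∫ x, g x ∂(Measure.pi fun _ : σ => ν) ≤ ∫ x, h x ∂(Measure.pi fun _ : σ => ν) := by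
  rw [integral_pi_eq_integral_update hL i hg, integral_pi_eq_integral_update hL i hh]
  have hi : ∀ {g : (σ → ℝ) → ℝ}, Continuous g → Integrable
      (fun x => ∫ y, g (Function.update x i y) ∂ν) (Measure.pi fun _ : σ => ν) := fun hg =>
    (((measurePreserving_update (ν := ν) i).integrable_comp
      hg.measurable.aestronglyMeasurable).mpr
        (integrable_pi_of_continuous hL hg)).integral_prod_left
  exact integral_mono (hi hg) (hi hh) hgh

/-- Integrate the hypothesis over two independent copies. By symmetry each side is twice a single
integral, and integrating out one copy turns `(a y - a z) ^ 2` into the quadratic in `a y`. -/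
theorem sub_mul_sub_integral (hL : ∀ᵐ y ∂ν, |y| ≤ L) {a φ ψ : ℝ → ℝ} (ha : Continuous a)
    (hφ : Continuous φ) (hψ : Continuous ψ) {c : ℝ}
    (h : ∀ y z, (a y - a z) * (φ y - φ z) ≤ c * ((a y - a z) ^ 2 * (ψ y + ψ z))) :
    ∫ y, (a y - ∫ z, a z ∂ν) * φ y ∂ν
      ≤ c * ∫ y, (a y ^ 2 - 2 * (∫ z, a z ∂ν) * a y + ∫ z, a z ^ 2 ∂ν) * ψ y ∂ν := by
  have I : ∀ {g : ℝ → ℝ}, Continuous g → Integrable g ν := fun hg => integrable_of_continuous hL hg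
  have J : ∀ {g : ℝ × ℝ → ℝ}, Continuous g → Integrable g (ν.prod ν) :=
    fun hg => integrable_prod_of_continuous hL hg
  have key : ∫ p : ℝ × ℝ, (a p.1 - a p.2) * (φ p.1 - φ p.2) ∂(ν.prod ν)
      ≤ ∫ p : ℝ × ℝ, c * ((a p.1 - a p.2) ^ 2 * (ψ p.1 + ψ p.2)) ∂(ν.prod ν) :=
    integral_mono (J (by fun_prop)) (J (by fun_prop)) fun p => h p.1 p.2
  set A := ∫ z, a z ∂ν
  set B := ∫ z, a z ^ 2 ∂ν
  have e1 : ∫ p : ℝ × ℝ, (a p.1 - a p.2) * (φ p.1 - φ p.2) ∂(ν.prod ν)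
      = 2 * ∫ y, (a y - A) * φ y ∂ν := by
    have l : ∫ p : ℝ × ℝ, (a p.1 - a p.2) * (φ p.1 - φ p.2) ∂(ν.prod ν)
        = ∫ p : ℝ × ℝ, (a p.1 * φ p.1) * 1 + 1 * (a p.2 * φ p.2)
          - (a p.1 * φ p.2 + φ p.1 * a p.2) ∂(ν.prod ν) := by
      congr 1; ext p; ring
    have r : ∫ y, (a y - A) * φ y ∂ν = ∫ y, a y * φ y - A * φ y ∂ν := by
      congr 1; ext p; ring
    rw [l, r, integral_sub (J (by fun_prop)) (J (by fun_prop)),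
      integral_add (J (by fun_prop)) (J (by fun_prop)),
      integral_add (J (by fun_prop)) (J (by fun_prop)),
      integral_prod_mul (fun y => a y * φ y) (fun _ => (1 : ℝ)),
      integral_prod_mul (fun _ => (1 : ℝ)) (fun y => a y * φ y), integral_prod_mul a φ,
      integral_prod_mul φ a,
      integral_sub (I (by fun_prop)) (I (by fun_prop)), integral_const_mul]
    simp
    ring
  have e2 : ∫ p : ℝ × ℝ, c * ((a p.1 - a p.2) ^ 2 * (ψ p.1 + ψ p.2)) ∂(ν.prod ν)
      = 2 * (c * ∫ y, (a y ^ 2 - 2 * A * a y + B) * ψ y ∂ν) := by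
    have l : ∫ p : ℝ × ℝ, c * ((a p.1 - a p.2) ^ 2 * (ψ p.1 + ψ p.2)) ∂(ν.prod ν)
        = c * ∫ p : ℝ × ℝ, ((a p.1 ^ 2 * ψ p.1) * 1 + 1 * (a p.2 ^ 2 * ψ p.2))
          + (a p.1 ^ 2 * ψ p.2 + ψ p.1 * a p.2 ^ 2)
          - (2 * ((a p.1 * ψ p.1) * a p.2) + 2 * (a p.1 * (a p.2 * ψ p.2))) ∂(ν.prod ν) := by
      rw [← integral_const_mul]
      congr 1; ext p; ring
    have r : ∫ y, (a y ^ 2 - 2 * A * a y + B) * ψ y ∂ν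
        = ∫ y, a y ^ 2 * ψ y - 2 * A * (a y * ψ y) + B * ψ y ∂ν := by
      congr 1; ext p; ring
    rw [l, r, integral_sub (J (by fun_prop)) (J (by fun_prop)),
      integral_add (J (by fun_prop)) (J (by fun_prop)),
      integral_add (J (by fun_prop)) (J (by fun_prop)),
      integral_add (J (by fun_prop)) (J (by fun_prop)),
      integral_add (J (by fun_prop)) (J (by fun_prop)), integral_const_mul (2 : ℝ),
      integral_const_mul (2 : ℝ),
      integral_prod_mul (fun y => a y ^ 2 * ψ y) (fun _ => (1 : ℝ)),
      integral_prod_mul (fun _ => (1 : ℝ)) (fun y => a y ^ 2 * ψ y),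
      integral_prod_mul (fun y => a y ^ 2) ψ, integral_prod_mul ψ (fun y => a y ^ 2),
      integral_prod_mul (fun y => a y * ψ y) a, integral_prod_mul a (fun y => a y * ψ y),
      integral_add (I (by fun_prop)) (I (by fun_prop)),
      integral_sub (I (by fun_prop)) (I (by fun_prop)), integral_const_mul, integral_const_mul]
    simp
    ring
  rw [e1, e2] at key
  linarith

variable {ι : Type*} [Fintype ι] [DecidableEq ι]

theorem continuous_trace_mul_cfc {X : Type*} [TopologicalSpace X] {f : ℝ → ℝ} (hf : Continuous f)
    {Q A : X → Matrix ι ι ℝ} (hQ : Continuous Q) (hA : Continuous A)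
    (hA' : ∀ x, (A x).IsHermitian) : Continuous fun x => (Q x * cfc f (A x)).trace :=
  (hQ.matrix_mul (continuous_cfc_comp hf hA hA')).matrix_trace

theorem continuous_trace_cfc {X : Type*} [TopologicalSpace X] {f : ℝ → ℝ} (hf : Continuous f)
    {A : X → Matrix ι ι ℝ} (hA : Continuous A)
    (hA' : ∀ x, (A x).IsHermitian) : Continuous fun x => (cfc f (A x)).trace :=
  (continuous_cfc_comp hf hA hA').matrix_trace

theorem integral_sub_mul_trace_mul_cfc_le (hL : ∀ᵐ y ∂ν, |y| ≤ L) {a : ℝ → ℝ}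
    (ha : Continuous a) {C Q : Matrix ι ι ℝ} (hC : C.IsHermitian) (hQ : Q.IsHermitian) {q : ℝ}
    (hq : 1 ≤ q) :
    ∫ y, (a y - ∫ z, a z ∂ν) * (Q * cfc (fun s : ℝ => s * |s| ^ q) (C + a y • Q)).trace ∂ν
      ≤ (q + 1) * ∫ y, (a y ^ 2 - 2 * (∫ z, a z ∂ν) * a y + ∫ z, a z ^ 2 ∂ν)
          * (Q * Q * cfc (fun s : ℝ => |s| ^ q) (C + a y • Q)).trace ∂ν := by
  have hH : ∀ y, (C + a y • Q).IsHermitian := fun y =>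
    hC.add (by rw [Matrix.IsHermitian, conjTranspose_smul, hQ]; simp)
  have hc : Continuous fun y => C + a y • Q := by fun_prop
  refine sub_mul_sub_integral hL ha
    (continuous_trace_mul_cfc (continuous_mul_abs_rpow (by linarith)) continuous_const hc hH)
    (continuous_trace_mul_cfc (continuous_abs_rpow (by linarith)) continuous_const hc hH)
    fun y z => ?_
  have h := trace_sub_mul_cfc_sub_cfc_le (hH y) (hH z) hq
  have e : C + a y • Q - (C + a z • Q) = (a y - a z) • Q := by rw [sub_smul]; abel
  rw [e] at h
  simp only [smul_mul_assoc, mul_smul_comm, trace_smul, smul_eq_mul, mul_sub, trace_sub] at h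
  linarith

/-- `H` is adapted to the set of active coordinates if every coordinate is either inactive, and its
matrix vanishes, or none of the matrices depends on it. -/
def Adapted {M : Type*} [Zero M] (H : σ → (σ → ℝ) → M) : Prop :=
  ∀ i, (∀ x, H i x = 0) ∨ ∀ j x y, H j (Function.update x i y) = H j x

/-- Each active coordinate is resampled alone: with the others frozen, `W` is affine in `a (x i)`
with constant slope `Q i`. Adaptedness provides this even though the matrices may depend on inactive
coordinates. -/
theorem integral_sum_sub_mul_trace_mul_cfc_le (hL : ∀ᵐ y ∂ν, |y| ≤ L) {a : ℝ → ℝ}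
    (ha : Continuous a) {Q : σ → (σ → ℝ) → Matrix ι ι ℝ} (hQc : ∀ i, Continuous (Q i))
    (hQ : ∀ i x, (Q i x).IsHermitian) (hadapt : Adapted Q) {q : ℝ} (hq : 1 ≤ q)
    {W : (σ → ℝ) → Matrix ι ι ℝ} (hW : ∀ x, W x = ∑ i, a (x i) • Q i x) :
    ∫ x, ∑ i, (a (x i) - ∫ z, a z ∂ν)
        * (Q i x * cfc (fun s : ℝ => s * |s| ^ q) (W x)).trace ∂(Measure.pi fun _ : σ => ν)
      ≤ (q + 1) * ∫ x, ∑ i, (a (x i) ^ 2 - 2 * (∫ z, a z ∂ν) * a (x i) + ∫ z, a z ^ 2 ∂ν)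
          * (Q i x * Q i x * cfc (fun s : ℝ => |s| ^ q) (W x)).trace
          ∂(Measure.pi fun _ : σ => ν) := by
  have hsm : ∀ (c : ℝ) i x, (c • Q i x).IsHermitian := fun c i x => by
    rw [Matrix.IsHermitian, conjTranspose_smul, hQ]; simp
  have hsum : ∀ (s : Finset σ) (c : σ → ℝ) x, (∑ i ∈ s, c i • Q i x).IsHermitian :=
    fun s c x => by
      rw [Matrix.IsHermitian, conjTranspose_sum]
      exact Finset.sum_congr rfl fun i _ => hsm _ _ _
  have hWH : ∀ x, (W x).IsHermitian := fun x => hW x ▸ hsum _ _ _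
  have hWc : Continuous W := by
    rw [funext hW]
    fun_prop
  have c1 : ∀ i, Continuous fun x => (Q i x * cfc (fun s : ℝ => s * |s| ^ q) (W x)).trace :=
    fun i => continuous_trace_mul_cfc (continuous_mul_abs_rpow (by linarith)) (hQc i) hWc hWH
  have c2 : ∀ i, Continuous fun x => (Q i x * Q i x * cfc (fun s : ℝ => |s| ^ q) (W x)).trace :=
    fun i => continuous_trace_mul_cfc (continuous_abs_rpow (by linarith))
      ((hQc i).matrix_mul (hQc i)) hWc hWH
  rw [integral_finsetSum _ fun i _ => integrable_pi_of_continuous hL (by fun_prop),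
    integral_finsetSum _ fun i _ => integrable_pi_of_continuous hL (by fun_prop),
    Finset.mul_sum]
  refine Finset.sum_le_sum fun i _ => ?_
  rcases hadapt i with h0 | hi
  · simp [h0]
  rw [← integral_const_mul]
  refine integral_pi_mono_update hL i (by fun_prop) (by fun_prop) fun x => ?_
  have hWu : ∀ y, W (Function.update x i y)
      = (∑ j ∈ Finset.univ.erase i, a (x j) • Q j x) + a y • Q i x := fun y => by
    rw [hW, ← Finset.sum_erase_add _ _ (Finset.mem_univ i)]
    simp only [hi, Function.update_self]
    congr 1
    refine Finset.sum_congr rfl fun j hj => ?_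
    rw [Function.update_of_ne (Finset.ne_of_mem_erase hj)]
  simp only [hi, hWu, Function.update_self]
  rw [integral_const_mul]
  exact integral_sub_mul_trace_mul_cfc_le hL ha (hsum _ _ _) (hQ i x) hq

end Bounded

/-! ### Rosenthal inequalities for symmetric matrices -/

section Rosenthal

variable {ν : Measure ℝ} [IsProbabilityMeasure ν] {L : ℝ} {σ ι : Type*} [Fintype σ]
  [DecidableEq σ] [Fintype ι] [DecidableEq ι]

theorem isHermitian_sum {ι κ : Type*} {s : Finset κ} {A : κ → Matrix ι ι ℝ}
    (hA : ∀ i ∈ s, (A i).IsHermitian) : (∑ i ∈ s, A i).IsHermitian := by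
  rw [Matrix.IsHermitian, conjTranspose_sum]
  exact Finset.sum_congr rfl hA

theorem isHermitian_smul {ι : Type*} {A : Matrix ι ι ℝ} (hA : A.IsHermitian) (c : ℝ) :
    (c • A).IsHermitian := by
  rw [Matrix.IsHermitian, conjTranspose_smul, hA]; simp

theorem trace_mul_cfc_mul_abs_rpow {A : Matrix ι ι ℝ} (hA : A.IsHermitian) {q : ℝ} (hq : 2 ≤ q) :
    (A * cfc (fun s : ℝ => s * |s| ^ (q - 2)) A).trace
      = (cfc (fun s : ℝ => |s| ^ q) A).trace := by
  rw [mul_cfc_eq hA (continuous_mul_abs_rpow (by linarith))]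
  congr 2
  ext s
  rcases eq_or_ne s 0 with rfl | hs
  · simp [Real.zero_rpow (show q ≠ 0 by linarith)]
  · have : |s| ^ q = |s| ^ (q - 2) * |s| ^ (2 : ℝ) := by
      rw [← Real.rpow_add (abs_pos.mpr hs)]; norm_num
    rw [this, Real.rpow_two, sq_abs]
    ring

theorem rpow_sub_one_mul_self {x r : ℝ} (hx : 0 ≤ x) (hr : r ≠ 0) : x ^ (r - 1) * x = x ^ r := by
  rcases hx.eq_or_lt with rfl | hx
  · simp [Real.zero_rpow hr]
  · rw [← Real.rpow_add_one hx.ne']; congr 1; ring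

theorem one_le_of_integral_sq_eq_one (hL : ∀ᵐ y ∂ν, |y| ≤ L) (h2 : ∫ y, y ^ 2 ∂ν = 1) :
    1 ≤ L := by
  obtain ⟨y, hy⟩ := hL.exists
  have hL0 : 0 ≤ L := (abs_nonneg y).trans hy
  have : ∫ y, y ^ 2 ∂ν ≤ ∫ _, L ^ 2 ∂ν := by
    refine integral_mono_ae (integrable_of_continuous hL (by fun_prop)) (integrable_const _) ?_
    filter_upwards [hL] with y hy
    exact sq_le_sq' (abs_le.mp hy).1 (abs_le.mp hy).2
  simp only [h2, integral_const, probReal_univ, one_smul] at this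
  nlinarith

theorem integral_pow_four_le (hL : ∀ᵐ y ∂ν, |y| ≤ L) (h2 : ∫ y, y ^ 2 ∂ν = 1) :
    ∫ y, (y ^ 2) ^ 2 ∂ν ≤ L ^ 2 := by
  calc ∫ y, (y ^ 2) ^ 2 ∂ν ≤ ∫ y, L ^ 2 * y ^ 2 ∂ν := by
        refine integral_mono_ae (integrable_of_continuous hL (by fun_prop))
          (integrable_of_continuous hL (by fun_prop)) ?_
        filter_upwards [hL] with y hy
        have : y ^ 2 ≤ L ^ 2 := sq_le_sq' (abs_le.mp hy).1 (abs_le.mp hy).2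
        nlinarith [sq_nonneg y]
    _ = L ^ 2 := by rw [integral_const_mul, h2, mul_one]

/-- Summed over the coordinates, the last two terms become multiples of the traces of `S ^ r` and `D
* S ^ (r - 1)`, with `D = ∑ Q_i`, which can be absorbed. Young's inequality is used with `c = y ^ 2`
and with `c = L ^ 2`. -/
theorem sq_sub_mul_trace_le {Q S : Matrix ι ι ℝ} (hQ : Q.PosSemidef) (hS : S.PosSemidef)
    {κ r L m y : ℝ} (hκ : 0 < κ) (hr : 2 ≤ r) (hL : 1 ≤ L) (hy : |y| ≤ L) (hm : m ≤ L ^ 2) :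
    ((y ^ 2) ^ 2 - 2 * 1 * y ^ 2 + m) * (Q * Q * cfc (fun s : ℝ => |s| ^ (r - 2)) S).trace
      ≤ 2 * κ ^ (r - 2) * ((L ^ 2) ^ r * (cfc (fun s : ℝ => |s| ^ r) Q).trace)
        + κ⁻¹ * (y ^ 2 * (Q * cfc (fun s : ℝ => |s| ^ (r - 1)) S).trace
          + (Q * cfc (fun s : ℝ => |s| ^ (r - 1)) S).trace) := by
  have hyL : y ^ 2 ≤ L ^ 2 := sq_le_sq' (abs_le.mp hy).1 (abs_le.mp hy).2
  have hL21 : 1 ≤ L ^ 2 := by nlinarith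
  have hy0 := sq_nonneg y
  have hQQ : (Q * Q).PosSemidef := by
    have := Matrix.posSemidef_conjTranspose_mul_self Q
    rwa [hQ.isHermitian] at this
  have ht := trace_mul_cfc_nonneg hQQ hS (f := fun s : ℝ => |s| ^ (r - 2))
    fun s _ => by positivity
  have hq := cfc_abs_rpow_nonneg_trace hQ.isHermitian r
  have y1 := mul_trace_mul_self_mul_cfc_abs_rpow_le hQ hS.isHermitian hκ hr hy0
  have y2 := mul_trace_mul_self_mul_cfc_abs_rpow_le hQ hS.isHermitian hκ hr (sq_nonneg L)
  have p1 : y ^ 2 * (y ^ 2) ^ (r - 1) ≤ (L ^ 2) ^ r := by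
    rw [mul_comm, rpow_sub_one_mul_self hy0 (by linarith)]
    gcongr
  have p2 : (L ^ 2) ^ (r - 1) ≤ (L ^ 2) ^ r :=
    Real.rpow_le_rpow_of_exponent_le hL21 (by linarith)
  have y1' := mul_le_mul_of_nonneg_left y1 hy0
  have k0 : 0 ≤ κ ^ (r - 2) := by positivity
  have z1 := mul_le_mul_of_nonneg_right p1 (mul_nonneg k0 hq)
  have z2 := mul_le_mul_of_nonneg_right p2 (mul_nonneg k0 hq)
  have z3 : ((y ^ 2) ^ 2 - 2 * 1 * y ^ 2 + m)
        * (Q * Q * cfc (fun s : ℝ => |s| ^ (r - 2)) S).trace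
      ≤ ((y ^ 2) ^ 2 + L ^ 2) * (Q * Q * cfc (fun s : ℝ => |s| ^ (r - 2)) S).trace := by
    gcongr
    linarith
  linarith

/-- Rosenthal inequality for sums of random positive semidefinite matrices `x_i ^ 2 • Q_i`. -/
theorem integral_trace_sum_sq_smul_le (hL : ∀ᵐ y ∂ν, |y| ≤ L) (h2 : ∫ y, y ^ 2 ∂ν = 1)
    {Q : σ → (σ → ℝ) → Matrix ι ι ℝ} (hQc : ∀ i, Continuous (Q i))
    (hQ : ∀ i x, (Q i x).PosSemidef) (hadapt : Adapted Q) {r : ℝ} (hr : 3 ≤ r) :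
    ∫ x, (cfc (fun s : ℝ => |s| ^ r) (∑ i, x i ^ 2 • Q i x)).trace
        ∂(Measure.pi fun _ : σ => ν)
      ≤ 5 ^ r * ∫ x, (cfc (fun s : ℝ => |s| ^ r) (∑ i, Q i x)).trace
          ∂(Measure.pi fun _ : σ => ν)
        + (4 * r) ^ r * ((L ^ 2) ^ r * ∫ x, ∑ i, (cfc (fun s : ℝ => |s| ^ r) (Q i x)).trace
          ∂(Measure.pi fun _ : σ => ν)) := by
  have hL1 := one_le_of_integral_sq_eq_one hL h2
  set π := Measure.pi fun _ : σ => ν with hπ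
  set S : (σ → ℝ) → Matrix ι ι ℝ := fun x => ∑ i, x i ^ 2 • Q i x with hS
  set D : (σ → ℝ) → Matrix ι ι ℝ := fun x => ∑ i, Q i x with hD
  have hSp : ∀ x, (S x).PosSemidef := fun x =>
    Matrix.posSemidef_sum _ fun i _ => (hQ i x).smul (sq_nonneg _)
  have hDp : ∀ x, (D x).PosSemidef := fun x => Matrix.posSemidef_sum _ fun i _ => hQ i x
  have hSc : Continuous S := by fun_prop
  have hDc : Continuous D := by fun_prop
  have I : ∀ {g : (σ → ℝ) → ℝ}, Continuous g → Integrable g π :=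
    fun hg => integrable_pi_of_continuous hL hg
  have cr : Continuous fun s : ℝ => |s| ^ r := continuous_abs_rpow (by linarith)
  have cr1 : Continuous fun s : ℝ => |s| ^ (r - 1) := continuous_abs_rpow (by linarith)
  have cr2 : Continuous fun s : ℝ => |s| ^ (r - 2) := continuous_abs_rpow (by linarith)
  have cQ : ∀ i, Continuous fun x => (cfc (fun s : ℝ => |s| ^ r) (Q i x)).trace :=
    fun i => continuous_trace_cfc cr (hQc i) fun x => (hQ i x).isHermitian
  have cSr : Continuous fun x => (cfc (fun s : ℝ => |s| ^ r) (S x)).trace :=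
    continuous_trace_cfc cr hSc fun x => (hSp x).isHermitian
  have cDr : Continuous fun x => (cfc (fun s : ℝ => |s| ^ r) (D x)).trace :=
    continuous_trace_cfc cr hDc fun x => (hDp x).isHermitian
  have cDS : Continuous fun x => (D x * cfc (fun s : ℝ => |s| ^ (r - 1)) (S x)).trace :=
    continuous_trace_mul_cfc cr1 hDc hSc fun x => (hSp x).isHermitian
  have cQS : ∀ i, Continuous fun x =>
      (Q i x * Q i x * cfc (fun s : ℝ => |s| ^ (r - 2)) (S x)).trace := fun i =>
    continuous_trace_mul_cfc cr2 ((hQc i).matrix_mul (hQc i)) hSc fun x => (hSp x).isHermitian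
  have main := integral_sum_sub_mul_trace_mul_cfc_le hL (a := fun y => y ^ 2) (by fun_prop) hQc
    (fun i x => (hQ i x).isHermitian) hadapt (q := r - 2) (by linarith) (W := S) fun x => rfl
  have trS : ∀ x M, (S x * M).trace = ∑ i, x i ^ 2 * (Q i x * M).trace := fun x M => by
    simp only [hS, Finset.sum_mul, trace_sum, smul_mul_assoc, trace_smul, smul_eq_mul]
  have trD : ∀ x M, (D x * M).trace = ∑ i, (Q i x * M).trace := fun x M => by
    simp only [hD, Finset.sum_mul, trace_sum]
  clear_value S D
  have hf : ∀ x, cfc (fun s : ℝ => s * |s| ^ (r - 2)) (S x)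
      = cfc (fun s : ℝ => |s| ^ (r - 1)) (S x) := fun x =>
    cfc_congr_of_posSemidef (hSp x) fun s hs => by
      rw [abs_of_nonneg hs, mul_comm, show r - 2 = r - 1 - 1 by ring,
        rpow_sub_one_mul_self hs (by linarith)]
  have hSS : ∀ x, (S x * cfc (fun s : ℝ => |s| ^ (r - 1)) (S x)).trace
      = (cfc (fun s : ℝ => |s| ^ r) (S x)).trace := fun x => by
    rw [← hf, trace_mul_cfc_mul_abs_rpow (hSp x).isHermitian (by linarith)]
  rw [h2] at main
  have lhs : ∀ x : σ → ℝ, ∑ i, (x i ^ 2 - 1)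
        * (Q i x * cfc (fun s : ℝ => s * |s| ^ (r - 2)) (S x)).trace
      = (cfc (fun s : ℝ => |s| ^ r) (S x)).trace
        - (D x * cfc (fun s : ℝ => |s| ^ (r - 1)) (S x)).trace := fun x => by
    rw [hf, ← hSS, trS, trD]
    simp only [sub_mul, one_mul, Finset.sum_sub_distrib]
  simp only [lhs] at main
  rw [integral_sub (I cSr) (I cDS)] at main
  set u := ∫ x, (cfc (fun s : ℝ => |s| ^ r) (S x)).trace ∂π with hu
  set e := ∫ x, (D x * cfc (fun s : ℝ => |s| ^ (r - 1)) (S x)).trace ∂π with he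
  set dd := ∫ x, (cfc (fun s : ℝ => |s| ^ r) (D x)).trace ∂π with hdd
  set T := (L ^ 2) ^ r * ∫ x, ∑ i, (cfc (fun s : ℝ => |s| ^ r) (Q i x)).trace ∂π with hT
  have hr0 : (0 : ℝ) < 4 * r := by linarith
  have rhs : ∫ x, ∑ i, ((x i ^ 2) ^ 2 - 2 * 1 * x i ^ 2 + ∫ z, (z ^ 2) ^ 2 ∂ν)
          * (Q i x * Q i x * cfc (fun s : ℝ => |s| ^ (r - 2)) (S x)).trace ∂π
      ≤ 2 * (4 * r) ^ (r - 2) * T + (4 * r)⁻¹ * (u + e) := by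
    have e1 : 2 * (4 * r) ^ (r - 2) * T + (4 * r)⁻¹ * (u + e)
        = ∫ x, 2 * (4 * r) ^ (r - 2)
            * ((L ^ 2) ^ r * ∑ i, (cfc (fun s : ℝ => |s| ^ r) (Q i x)).trace)
          + (4 * r)⁻¹ * ((cfc (fun s : ℝ => |s| ^ r) (S x)).trace
            + (D x * cfc (fun s : ℝ => |s| ^ (r - 1)) (S x)).trace) ∂π := by
      rw [integral_add (I (by fun_prop)) (I (by fun_prop)), integral_const_mul,
        integral_const_mul, integral_const_mul, integral_add (I cSr) (I cDS)]
    rw [e1]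
    refine integral_mono_ae (I (by fun_prop)) (I (by fun_prop)) ?_
    filter_upwards [ae_pi_abs_le (σ := σ) hL] with x hx
    have hterm := fun i => sq_sub_mul_trace_le (hQ i x) (hSp x) (κ := 4 * r) (r := r) hr0
      (by linarith) hL1 (hx i) (integral_pow_four_le hL h2)
    refine (Finset.sum_le_sum fun i _ => hterm i).trans_eq ?_
    rw [Finset.sum_add_distrib, ← Finset.mul_sum, ← Finset.mul_sum, ← Finset.mul_sum, ← hSS,
      Finset.sum_add_distrib, trS, trD]
  have he5 : e ≤ 5 ^ (r - 1) * dd + 5⁻¹ * u := by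
    rw [hdd, hu, ← integral_const_mul, ← integral_const_mul,
      ← integral_add (I (by fun_prop)) (I (by fun_prop))]
    refine integral_mono (I cDS) (I (by fun_prop)) fun x => ?_
    -- Since `e` enters below with coefficient at most `5 / 4`, the choice `κ = 5` costs `u / 4`;
    -- together with the `u / 4` from `w2`, half of `u` stays on the left.
    simpa using trace_mul_cfc_abs_rpow_le (hDp x) (hSp x).isHermitian (κ := 5) (r := r) 1
      (by norm_num) (by linarith)
  have hT0 : 0 ≤ T := mul_nonneg (by positivity) (integral_nonneg fun x =>
    Finset.sum_nonneg fun i _ => cfc_abs_rpow_nonneg_trace (hQ i x).isHermitian r)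
  have hu0 : 0 ≤ u := integral_nonneg fun x => cfc_abs_rpow_nonneg_trace (hSp x).isHermitian r
  have he0 : 0 ≤ e := integral_nonneg fun x =>
    trace_mul_cfc_nonneg (hDp x) (hSp x) fun s _ => by positivity
  have hdd0 : 0 ≤ dd := integral_nonneg fun x => cfc_abs_rpow_nonneg_trace (hDp x).isHermitian r
  have q1 : (5 : ℝ) ^ (r - 1) * 5 = 5 ^ r := rpow_sub_one_mul_self (by norm_num) (by linarith)
  have q2 : (4 * r) ^ (r - 2) * (4 * r) = (4 * r) ^ (r - 1) := by
    rw [show r - 2 = r - 1 - 1 by ring, rpow_sub_one_mul_self hr0.le (by linarith)]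
  have q3 : (4 * r) ^ (r - 1) * (4 * r) = (4 * r) ^ r :=
    rpow_sub_one_mul_self hr0.le (by linarith)
  have k0 : 0 ≤ (4 * r) ^ (r - 2) := by positivity
  have k1 : 0 ≤ (4 * r) ^ (r - 1) := by positivity
  have main2 := main.trans (mul_le_mul_of_nonneg_left rhs (by linarith))
  have w1 : (r - 2 + 1) * (2 * (4 * r) ^ (r - 2) * T) ≤ (4 * r) ^ (r - 1) * T / 2 := by
    rw [← q2]
    have := mul_nonneg k0 hT0
    nlinarith
  have w2 : (r - 2 + 1) * ((4 * r)⁻¹ * (u + e)) ≤ (u + e) / 4 := by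
    rw [← mul_assoc, ← div_eq_mul_inv, div_mul_eq_mul_div, div_le_div_iff₀ hr0 (by norm_num)]
    nlinarith
  have w3 : (4 * r) ^ (r - 1) * T ≤ (4 * r) ^ r * T := by
    rw [← q3]
    have := mul_nonneg k1 hT0
    nlinarith
  have goal : u ≤ 5 ^ r * dd + (4 * r) ^ r * T := by
    have k5 : 0 ≤ 5 ^ (r - 1) * dd := by positivity
    rw [← q1]
    rw [mul_add] at main2
    linarith
  rwa [hu, hdd, hS, hD] at goal

/-- Rosenthal inequality for sums of random symmetric matrices `x_i • H_i`. -/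
theorem integral_trace_sum_smul_le (hL : ∀ᵐ y ∂ν, |y| ≤ L) (h1 : ∫ y, y ∂ν = 0)
    (h2 : ∫ y, y ^ 2 ∂ν = 1)
    {H : σ → (σ → ℝ) → Matrix ι ι ℝ} (hHc : ∀ i, Continuous (H i))
    (hH : ∀ i x, (H i x).IsHermitian) (hadapt : Adapted H) {r : ℝ} (hr : 3 ≤ r) :
    ∫ x, (cfc (fun s : ℝ => |s| ^ (2 * r)) (∑ i, x i • H i x)).trace
        ∂(Measure.pi fun _ : σ => ν)
      ≤ (6 * r) ^ (2 * r) * (∫ x, (cfc (fun s : ℝ => |s| ^ r) (∑ i, H i x * H i x)).trace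
          ∂(Measure.pi fun _ : σ => ν)
        + (L ^ 2) ^ r * ∫ x, ∑ i, (cfc (fun s : ℝ => |s| ^ r) (H i x * H i x)).trace
          ∂(Measure.pi fun _ : σ => ν)) := by
  set π := Measure.pi fun _ : σ => ν with hπ
  have hQ : ∀ i x, (H i x * H i x).PosSemidef := fun i x => by
    have := Matrix.posSemidef_conjTranspose_mul_self (H i x)
    rwa [hH i x] at this
  have hQc : ∀ i, Continuous fun x => H i x * H i x := fun i => (hHc i).matrix_mul (hHc i)
  have stage := integral_trace_sum_sq_smul_le (σ := σ) hL h2 (Q := fun i x => H i x * H i x) hQc hQ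
    (fun i => (hadapt i).imp (fun h x => by simp [h]) fun h j x y => by simp [h]) hr
  set Z : (σ → ℝ) → Matrix ι ι ℝ := fun x => ∑ i, x i • H i x with hZ
  set S : (σ → ℝ) → Matrix ι ι ℝ := fun x => ∑ i, x i ^ 2 • (H i x * H i x) with hS
  set D : (σ → ℝ) → Matrix ι ι ℝ := fun x => ∑ i, H i x * H i x with hD
  have hZH : ∀ x, (Z x).IsHermitian := fun x =>
    isHermitian_sum fun i _ => isHermitian_smul (hH i x) _
  have hSp : ∀ x, (S x).PosSemidef := fun x =>
    Matrix.posSemidef_sum _ fun i _ => (hQ i x).smul (sq_nonneg _)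
  have hDp : ∀ x, (D x).PosSemidef := fun x => Matrix.posSemidef_sum _ fun i _ => hQ i x
  have hZc : Continuous Z := by fun_prop
  have hSc : Continuous S := by fun_prop
  have hDc : Continuous D := by fun_prop
  have I : ∀ {g : (σ → ℝ) → ℝ}, Continuous g → Integrable g π :=
    fun hg => integrable_pi_of_continuous hL hg
  have cr : Continuous fun s : ℝ => |s| ^ r := continuous_abs_rpow (by linarith)
  have cr2 : Continuous fun s : ℝ => |s| ^ (2 * r) := continuous_abs_rpow (by linarith)
  have cr3 : Continuous fun s : ℝ => |s| ^ (2 * (r - 1)) := continuous_abs_rpow (by linarith)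
  have cZ : Continuous fun x => (cfc (fun s : ℝ => |s| ^ (2 * r)) (Z x)).trace :=
    continuous_trace_cfc cr2 hZc hZH
  have cS : Continuous fun x => (cfc (fun s : ℝ => |s| ^ r) (S x)).trace :=
    continuous_trace_cfc cr hSc fun x => (hSp x).isHermitian
  have cD : Continuous fun x => (cfc (fun s : ℝ => |s| ^ r) (D x)).trace :=
    continuous_trace_cfc cr hDc fun x => (hDp x).isHermitian
  have cSZ : Continuous fun x => (S x * cfc (fun s : ℝ => |s| ^ (2 * (r - 1))) (Z x)).trace :=
    continuous_trace_mul_cfc cr3 hSc hZc hZH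
  have cDZ : Continuous fun x => (D x * cfc (fun s : ℝ => |s| ^ (2 * (r - 1))) (Z x)).trace :=
    continuous_trace_mul_cfc cr3 hDc hZc hZH
  have main := integral_sum_sub_mul_trace_mul_cfc_le hL (a := fun y => y) (by fun_prop) hHc
    hH hadapt (q := 2 * r - 2) (by linarith) (W := Z) fun x => rfl
  rw [h1, h2] at main
  have lhs : ∀ x : σ → ℝ, ∑ i, (x i - 0)
        * (H i x * cfc (fun s : ℝ => s * |s| ^ (2 * r - 2)) (Z x)).trace
      = (cfc (fun s : ℝ => |s| ^ (2 * r)) (Z x)).trace := fun x => by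
    rw [← trace_mul_cfc_mul_abs_rpow (hZH x) (by linarith)]
    simp only [hZ, Finset.sum_mul, trace_sum, smul_mul_assoc, trace_smul, smul_eq_mul, sub_zero]
  have rhs : ∀ x : σ → ℝ, ∑ i, (x i ^ 2 - 2 * 0 * x i + 1)
        * (H i x * H i x * cfc (fun s : ℝ => |s| ^ (2 * r - 2)) (Z x)).trace
      = (S x * cfc (fun s : ℝ => |s| ^ (2 * (r - 1))) (Z x)).trace
        + (D x * cfc (fun s : ℝ => |s| ^ (2 * (r - 1))) (Z x)).trace := fun x => by
    rw [show 2 * r - 2 = 2 * (r - 1) by ring]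
    simp only [hS, hD, Finset.sum_mul, trace_sum, smul_mul_assoc, trace_smul, smul_eq_mul,
      mul_zero, zero_mul, sub_zero, add_mul, one_mul, Finset.sum_add_distrib]
  simp only [lhs, rhs] at main
  rw [integral_add (I cSZ) (I cDZ)] at main
  set U := ∫ x, (cfc (fun s : ℝ => |s| ^ (2 * r)) (Z x)).trace ∂π with hU
  set u := ∫ x, (cfc (fun s : ℝ => |s| ^ r) (S x)).trace ∂π with hu
  set dd := ∫ x, (cfc (fun s : ℝ => |s| ^ r) (D x)).trace ∂π with hdd
  set T := (L ^ 2) ^ r * ∫ x, ∑ i, (cfc (fun s : ℝ => |s| ^ r) (H i x * H i x)).trace ∂π with hT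
  -- With Young parameter `8 * r`, each of the two applications returns at most `U / 4` after the
  -- factor `2 * r - 1`, so half of `U` is absorbed.
  have hr0 : (0 : ℝ) < 8 * r := by linarith
  have young : ∀ {A : (σ → ℝ) → Matrix ι ι ℝ}, Continuous A → (∀ x, (A x).PosSemidef) →
      ∫ x, (A x * cfc (fun s : ℝ => |s| ^ (2 * (r - 1))) (Z x)).trace ∂π
        ≤ (8 * r) ^ (r - 1) * ∫ x, (cfc (fun s : ℝ => |s| ^ r) (A x)).trace ∂π
          + (8 * r)⁻¹ * U := fun {A} hA hAp => by
    have cA : Continuous fun x => (cfc (fun s : ℝ => |s| ^ r) (A x)).trace :=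
      continuous_trace_cfc cr hA fun x => (hAp x).isHermitian
    rw [hU, ← integral_const_mul, ← integral_const_mul,
      ← integral_add (I (by fun_prop)) (I (by fun_prop))]
    exact integral_mono (I (continuous_trace_mul_cfc cr3 hA hZc hZH)) (I (by fun_prop)) fun x =>
      trace_mul_cfc_abs_rpow_le (hAp x) (hZH x) 2 hr0 (by linarith)
  have yS := young hSc hSp
  have yD := young hDc hDp
  have hT0 : 0 ≤ T := mul_nonneg (by positivity) (integral_nonneg fun x =>
    Finset.sum_nonneg fun i _ => cfc_abs_rpow_nonneg_trace (hQ i x).isHermitian r)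
  have hU0 : 0 ≤ U := integral_nonneg fun x => cfc_abs_rpow_nonneg_trace (hZH x) _
  have hu0 : 0 ≤ u := integral_nonneg fun x => cfc_abs_rpow_nonneg_trace (hSp x).isHermitian r
  have hdd0 : 0 ≤ dd := integral_nonneg fun x => cfc_abs_rpow_nonneg_trace (hDp x).isHermitian r
  have main2 := main.trans (mul_le_mul_of_nonneg_left (add_le_add yS yD)
    (by linarith : 0 ≤ 2 * r - 2 + 1))
  have q1 : (8 * r) ^ (r - 1) * (8 * r) = (8 * r) ^ r :=
    rpow_sub_one_mul_self hr0.le (by linarith)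
  have k1 : 0 ≤ (8 * r) ^ (r - 1) := by positivity
  have w1 : (2 * r - 2 + 1) * ((8 * r)⁻¹ * U) ≤ U / 4 := by
    rw [← mul_assoc, ← div_eq_mul_inv, div_mul_eq_mul_div, div_le_div_iff₀ hr0 (by norm_num)]
    nlinarith
  have w2 : (2 * r - 2 + 1) * ((8 * r) ^ (r - 1) * (u + dd)) ≤ (8 * r) ^ r * (u + dd) / 4 := by
    rw [← q1]
    have := mul_nonneg k1 (add_nonneg hu0 hdd0)
    nlinarith
  have w3 : U ≤ (8 * r) ^ r * (u + dd) / 2 := by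
    have e : (2 * r - 2 + 1) * ((8 * r) ^ (r - 1) * u + (8 * r)⁻¹ * U
          + ((8 * r) ^ (r - 1) * dd + (8 * r)⁻¹ * U))
        = (2 * r - 2 + 1) * ((8 * r) ^ (r - 1) * (u + dd))
          + 2 * ((2 * r - 2 + 1) * ((8 * r)⁻¹ * U)) := by ring
    linarith
  have k8 : 0 ≤ (8 * r) ^ r := by positivity
  have five : (1 : ℝ) ≤ 5 ^ r := Real.one_le_rpow (by norm_num) (by linarith)
  -- The base `6 * r` comes from `40 * r ≤ 36 * r ^ 2` here and `32 * r ^ 2 ≤ 36 * r ^ 2` in `c2`.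
  have c1 : (8 * r) ^ r * 5 ^ r ≤ (6 * r) ^ (2 * r) := by
    rw [Real.rpow_mul (by linarith), Real.rpow_two, ← Real.mul_rpow hr0.le (by norm_num)]
    gcongr
    nlinarith
  have c2 : (8 * r) ^ r * (4 * r) ^ r ≤ (6 * r) ^ (2 * r) := by
    rw [Real.rpow_mul (by linarith), Real.rpow_two, ← Real.mul_rpow hr0.le (by linarith)]
    gcongr
    nlinarith
  have v1 := mul_le_mul_of_nonneg_left stage k8
  have v2 := mul_le_mul_of_nonneg_right c1 hdd0
  have v3 := mul_le_mul_of_nonneg_right c2 hT0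
  have v4 := mul_le_mul_of_nonneg_right five (mul_nonneg k8 hdd0)
  have v5 := mul_nonneg (k8.trans (le_mul_of_one_le_right k8 five) |>.trans c1) hT0
  linarith

end Rosenthal

/-! ### Schatten powers, dilations and stacked blocks -/

section SchattenPow

variable {α β γ δ : Type*} [Fintype α] [Fintype β] [DecidableEq β] [Fintype γ] [Fintype δ]
  [DecidableEq δ]

/-- The `2r`-th power of the Schatten `2r`-norm: `tr (Mᵀ M) ^ r`. -/
def schattenPow (r : ℝ) (M : Matrix α β ℝ) : ℝ := (cfc (fun s : ℝ => |s| ^ r) (Mᵀ * M)).trace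

theorem posSemidef_transpose_mul {α β : Type*} [Fintype α] [Finite β] (M : Matrix α β ℝ) : (Mᵀ * M).PosSemidef := by
  simpa using Matrix.posSemidef_conjTranspose_mul_self M

theorem schattenPow_nonneg (r : ℝ) (M : Matrix α β ℝ) : 0 ≤ schattenPow r M :=
  cfc_abs_rpow_nonneg_trace (isHermitian_transpose_mul M) r

theorem schattenNorm_rpow {t : ℝ} (ht : 0 < t) (M : Matrix α β ℝ) :
    schattenNorm (4 * t) M ^ (4 * t) = schattenPow (2 * t) M := by
  have h : (cfc (fun s : ℝ => s ^ (4 * t / 2)) (Mᵀ * M)).trace = schattenPow (2 * t) M := by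
    rw [schattenPow, cfc_congr_of_posSemidef (posSemidef_transpose_mul M) fun s hs => ?_]
    rw [abs_of_nonneg hs]
    congr 1; ring
  rw [schattenNorm, h, ← Real.rpow_mul (schattenPow_nonneg _ _), one_div,
    inv_mul_cancel₀ (by positivity), Real.rpow_one]

theorem schattenPow_transpose [DecidableEq α] {r : ℝ} (hr : r ≠ 0) (M : Matrix α β ℝ) :
    schattenPow r Mᵀ = schattenPow r M := by
  rw [schattenPow, schattenPow, transpose_transpose]
  exact trace_cfc_mul_transpose M (by simp [Real.zero_rpow hr])

theorem schattenPow_smul {r : ℝ} (c : ℝ) (M : Matrix α β ℝ) :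
    schattenPow r (c • M) = (c ^ 2) ^ r * schattenPow r M := by
  rw [schattenPow, transpose_smul, Matrix.smul_mul, Matrix.mul_smul, smul_smul,
    trace_cfc_abs_rpow_smul (isHermitian_transpose_mul M), schattenPow, abs_mul_self, sq]

theorem schattenPow_zero {r : ℝ} (hr : r ≠ 0) : schattenPow r (0 : Matrix α β ℝ) = 0 := by
  have h := schattenPow_smul (r := r) 0 (0 : Matrix α β ℝ)
  simpa [Real.zero_rpow hr] using h

theorem schattenPow_submatrix (r : ℝ) (M : Matrix α β ℝ) (e : γ ≃ α) (f : δ ≃ β) :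
    schattenPow r (M.submatrix e f) = schattenPow r M := by
  rw [schattenPow, transpose_submatrix, submatrix_mul_equiv]
  exact trace_cfc_submatrix_equiv (isHermitian_transpose_mul M) _ f

/-- The Gram matrix decreases by `Mᵀ * diagonal (1 - ρ ^ 2) * M`, which is positive semidefinite,
and the trace power is monotone. -/
theorem schattenPow_diagonal_mul_le [DecidableEq α] {r : ℝ} (hr : 2 ≤ r) (M : Matrix α β ℝ)
    {ρ : α → ℝ} (hρ : ∀ a, |ρ a| ≤ 1) : schattenPow r (diagonal ρ * M) ≤ schattenPow r M := by
  refine trace_cfc_abs_rpow_mono (posSemidef_transpose_mul _) (isHermitian_transpose_mul M) ?_ hr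
  have h : Mᵀ * M - (diagonal ρ * M)ᵀ * (diagonal ρ * M)
      = Mᵀ * diagonal (fun a => 1 - ρ a ^ 2) * M := by
    have h1 : diagonal (fun a => 1 - ρ a ^ 2) = 1 - diagonal ρ * diagonal ρ := by
      rw [diagonal_mul_diagonal, ← diagonal_one, ← diagonal_sub]
      congr 1; ext a; simp [sq]
    rw [h1, transpose_mul, diagonal_transpose, Matrix.mul_sub, Matrix.sub_mul, Matrix.mul_one]
    simp only [Matrix.mul_assoc]
  rw [h, ← conjTranspose_eq_transpose_of_trivial]
  refine Matrix.PosSemidef.conjTranspose_mul_mul_same (Matrix.PosSemidef.diagonal fun a => ?_) M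
  have := (sq_le_one_iff_abs_le_one _).mpr (hρ a)
  simpa using this

/-- Multiplying rows and columns by numbers of modulus at most one decreases Schatten norms. -/
theorem schattenPow_scale_le [DecidableEq α] {r : ℝ} (hr : 2 ≤ r) (M : Matrix α β ℝ)
    {ρ : α → ℝ} {κ : β → ℝ} (hρ : ∀ a, |ρ a| ≤ 1) (hκ : ∀ b, |κ b| ≤ 1) :
    schattenPow r (Matrix.of fun a b => ρ a * κ b * M a b) ≤ schattenPow r M := by
  have h : (Matrix.of fun a b => ρ a * κ b * M a b) = diagonal ρ * (diagonal κ * Mᵀ)ᵀ := by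
    ext a b
    rw [Matrix.diagonal_mul, transpose_apply, Matrix.diagonal_mul, transpose_apply, of_apply]
    ring
  rw [h]
  refine (schattenPow_diagonal_mul_le hr _ hρ).trans ?_
  rw [schattenPow_transpose (by linarith)]
  refine (schattenPow_diagonal_mul_le hr _ hκ).trans ?_
  rw [schattenPow_transpose (by linarith)]

/-- The Hermitian dilation of a rectangular matrix. -/
def dilation {α β : Type*} (M : Matrix α β ℝ) : Matrix (α ⊕ β) (α ⊕ β) ℝ := fromBlocks 0 M Mᵀ 0

theorem isHermitian_dilation {α β : Type*} (M : Matrix α β ℝ) : (dilation M).IsHermitian :=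
  Matrix.IsHermitian.fromBlocks (by simp) (by simp) (by simp)

theorem dilation_mul_self (M : Matrix α β ℝ) :
    dilation M * dilation M = fromBlocks (M * Mᵀ) 0 0 (Mᵀ * M) := by
  simp [dilation, fromBlocks_multiply]

theorem trace_cfc_dilation_mul_self [DecidableEq α] {r : ℝ} (hr : 0 < r) (M : Matrix α β ℝ) :
    (cfc (fun s : ℝ => |s| ^ r) (dilation M * dilation M)).trace = 2 * schattenPow r M := by
  rw [dilation_mul_self, trace_cfc_fromBlocks (isHermitian_mul_transpose M)
    (isHermitian_transpose_mul M), trace_cfc_mul_transpose M (by simp [Real.zero_rpow hr.ne']),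
    schattenPow, two_mul]

/-- The square of the dilation is block diagonal with blocks `M * Mᵀ` and `Mᵀ * M`, which contribute
equally. This transfers results on symmetric matrices to rectangular ones. -/
theorem trace_cfc_dilation [DecidableEq α] {r : ℝ} (hr : 0 < r) (M : Matrix α β ℝ) :
    (cfc (fun s : ℝ => |s| ^ (2 * r)) (dilation M)).trace = 2 * schattenPow r M := by
  rw [← trace_cfc_dilation_mul_self hr, mul_self_eq_cfc (isHermitian_dilation M),
    ← cfc_comp' (fun s : ℝ => |s| ^ r) (fun s : ℝ => s * s) (dilation M)
      (continuous_abs_rpow hr.le).continuousOn (by fun_prop)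
      (isHermitian_dilation M).isSelfAdjoint]
  congr 2
  ext s
  rw [Real.rpow_mul (abs_nonneg s), Real.rpow_two, sq_abs, abs_mul_self, sq]

theorem dilation_add {α β : Type*} (M N : Matrix α β ℝ) : dilation (M + N) = dilation M + dilation N := by
  simp [dilation, fromBlocks_add]

theorem dilation_smul {α β : Type*} (c : ℝ) (M : Matrix α β ℝ) : dilation (c • M) = c • dilation M := by
  simp [dilation, fromBlocks_smul]

theorem dilation_sum {α β κ : Type*} (s : Finset κ) (M : κ → Matrix α β ℝ) :
    dilation (∑ i ∈ s, M i) = ∑ i ∈ s, dilation (M i) := by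
  classical
  induction s using Finset.induction_on with
  | empty => simp [dilation]
  | insert a s ha ih => rw [Finset.sum_insert ha, Finset.sum_insert ha, dilation_add, ih]

theorem continuous_dilation {α β : Type*} {X : Type*} [TopologicalSpace X] {M : X → Matrix α β ℝ}
    (hM : Continuous M) : Continuous fun x => dilation (M x) :=
  continuous_const.matrix_fromBlocks hM hM.matrix_transpose continuous_const

theorem continuous_schattenPow {X : Type*} [TopologicalSpace X] {M : X → Matrix α β ℝ} {r : ℝ}
    (hr : 0 ≤ r) (hM : Continuous M) : Continuous fun x => schattenPow r (M x) :=
  continuous_trace_cfc (continuous_abs_rpow hr) (hM.matrix_transpose.matrix_mul hM)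
    fun x => isHermitian_transpose_mul (M x)

/-- Convexity of the powers of Schatten norms. -/
theorem schattenPow_average_le [DecidableEq α] {r : ℝ} (hr : 1 ≤ r) {κ : Type*} [Fintype κ]
    [Nonempty κ] (M : κ → Matrix α β ℝ) :
    schattenPow r ((Fintype.card κ : ℝ)⁻¹ • ∑ c, M c)
      ≤ (Fintype.card κ : ℝ)⁻¹ * ∑ c, schattenPow r (M c) := by
  have hN : (Fintype.card κ : ℝ) ≠ 0 := by simp
  have hr0 : 0 < r := by linarith
  set A := dilation ((Fintype.card κ : ℝ)⁻¹ • ∑ c, M c) with hA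
  set G := cfc (fun s : ℝ => s * |s| ^ (2 * r - 2)) A
  have h := fun c => trace_cfc_abs_rpow_add_le (isHermitian_dilation _ : A.IsHermitian)
    (isHermitian_dilation (M c)) (q := 2 * r) (by linarith)
  have hs := Finset.sum_le_sum fun c (_ : c ∈ Finset.univ) => h c
  -- Tangents are taken at the average, so the linear terms cancel.
  have h0 : ∑ c, 2 * r * ((dilation (M c) - A) * G).trace = 0 := by
    rw [← Finset.mul_sum, ← trace_sum, ← Finset.sum_mul, Finset.sum_sub_distrib, ← dilation_sum,
      hA, dilation_smul, Finset.sum_const, Finset.card_univ, ← Nat.cast_smul_eq_nsmul ℝ,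
      smul_smul, mul_inv_cancel₀ hN, one_smul, sub_self, zero_mul, trace_zero, mul_zero]
  rw [Finset.sum_add_distrib, h0, add_zero, Finset.sum_const, Finset.card_univ,
    nsmul_eq_mul, trace_cfc_dilation hr0] at hs
  simp only [trace_cfc_dilation hr0] at hs
  rw [← Finset.mul_sum] at hs
  rw [inv_mul_eq_div, le_div_iff₀ (by positivity)]
  linarith

variable {σ : Type*} [Fintype σ]

/-- Matrices stacked vertically. -/
def vstack {α β σ : Type*} (B : σ → Matrix α β ℝ) : Matrix (σ × α) β ℝ := Matrix.of fun u s => B u.1 u.2 s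

/-- Matrices side by side. -/
def hstack {α β σ : Type*} (B : σ → Matrix α β ℝ) : Matrix α (σ × β) ℝ := Matrix.of fun r v => B v.1 r v.2

/-- The block diagonal matrix with given blocks. -/
def dstack {α β σ : Type*} [DecidableEq σ] (B : σ → Matrix α β ℝ) : Matrix (σ × α) (σ × β) ℝ :=
  Matrix.of fun u v => if u.1 = v.1 then B u.1 u.2 v.2 else 0

theorem schattenPow_vstack (r : ℝ) (B : σ → Matrix α β ℝ) :
    schattenPow r (vstack B) = (cfc (fun s : ℝ => |s| ^ r) (∑ i, (B i)ᵀ * B i)).trace := by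
  have : (vstack B)ᵀ * vstack B = ∑ i, (B i)ᵀ * B i := by
    ext s s'
    simp [Matrix.mul_apply, Matrix.sum_apply, vstack, Fintype.sum_prod_type]
  rw [schattenPow, this]

theorem schattenPow_hstack [DecidableEq α] [DecidableEq σ] {r : ℝ} (hr : r ≠ 0) (B : σ → Matrix α β ℝ) :
    schattenPow r (hstack B) = (cfc (fun s : ℝ => |s| ^ r) (∑ i, B i * (B i)ᵀ)).trace := by
  rw [← schattenPow_transpose hr]
  have h : (hstack B)ᵀ = vstack fun i => (B i)ᵀ := rfl
  rw [h, schattenPow_vstack]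
  simp only [transpose_transpose]

theorem schattenPow_dstack [DecidableEq σ] (r : ℝ) (B : σ → Matrix α β ℝ) :
    schattenPow r (dstack B) = ∑ i, schattenPow r (B i) := by
  have : (dstack B)ᵀ * dstack B
      = (blockDiagonal fun i => (B i)ᵀ * B i).submatrix (Equiv.prodComm _ _)
        (Equiv.prodComm _ _) := by
    ext ⟨i, s⟩ ⟨j, s'⟩
    simp only [Matrix.mul_apply, dstack, transpose_apply, of_apply, Fintype.sum_prod_type,
      submatrix_apply, Equiv.prodComm_apply, Prod.swap_prod_mk, blockDiagonal_apply]
    rw [Finset.sum_eq_single i (fun k _ hk => by simp [hk]) (by simp)]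
    by_cases hij : i = j
    · simp [hij]
    · simp [hij]
  have hB : ∀ i, ((B i)ᵀ * B i).IsHermitian := fun i => isHermitian_transpose_mul _
  have hD : (blockDiagonal fun i => (B i)ᵀ * B i).IsHermitian := by
    rw [Matrix.IsHermitian, blockDiagonal_conjTranspose]
    exact congrArg _ (funext hB)
  rw [schattenPow, this, trace_cfc_submatrix_equiv hD, trace_cfc_blockDiagonal hB]
  rfl

/-- Noncommutative Rosenthal inequality for rectangular matrices with scalar random
coefficients. -/
theorem integral_schattenPow_sum_smul_le [DecidableEq α] [DecidableEq σ] {ν : Measure ℝ} [IsProbabilityMeasure ν]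
    {L : ℝ} (hL : ∀ᵐ y ∂ν, |y| ≤ L) (h1 : ∫ y, y ∂ν = 0) (h2 : ∫ y, y ^ 2 ∂ν = 1)
    {B : σ → (σ → ℝ) → Matrix α β ℝ} (hBc : ∀ i, Continuous (B i)) (hadapt : Adapted B)
    {r : ℝ} (hr : 3 ≤ r) :
    ∫ x, schattenPow r (∑ i, x i • B i x) ∂(Measure.pi fun _ : σ => ν)
      ≤ (6 * r) ^ (2 * r) * (∫ x, schattenPow r (vstack fun i => B i x)
            ∂(Measure.pi fun _ : σ => ν)
          + ∫ x, schattenPow r (hstack fun i => B i x) ∂(Measure.pi fun _ : σ => ν)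
          + (L ^ 2) ^ r * ∫ x, schattenPow r (dstack fun i => B i x)
            ∂(Measure.pi fun _ : σ => ν)) := by
  have hr0 : 0 < r := by linarith
  have main := integral_trace_sum_smul_le hL h1 h2 (H := fun i x => dilation (B i x))
    (fun i => continuous_dilation (hBc i)) (fun i x => isHermitian_dilation _)
    (fun i => (hadapt i).imp (fun h x => by simp [h, dilation]) fun h j x y => by simp [h]) hr
  have e1 : ∀ x : σ → ℝ, ∑ i, x i • dilation (B i x) = dilation (∑ i, x i • B i x) := fun x => by
    simp only [dilation_sum, dilation_smul]
  have e2 : ∀ x : σ → ℝ, (cfc (fun s : ℝ => |s| ^ r)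
        (∑ i, dilation (B i x) * dilation (B i x))).trace
      = schattenPow r (hstack fun i => B i x) + schattenPow r (vstack fun i => B i x) := fun x => by
    have : ∑ i, dilation (B i x) * dilation (B i x)
        = fromBlocks (∑ i, B i x * (B i x)ᵀ) 0 0 (∑ i, (B i x)ᵀ * B i x) := by
      ext u v
      rcases u with u | u <;> rcases v with v | v <;> simp [dilation_mul_self, Matrix.sum_apply]
    rw [this, trace_cfc_fromBlocks (isHermitian_sum fun i _ => isHermitian_mul_transpose _)
      (isHermitian_sum fun i _ => isHermitian_transpose_mul _), schattenPow_hstack hr0.ne',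
      schattenPow_vstack]
  have ch : Continuous fun x : σ → ℝ => schattenPow r (hstack fun i => B i x) :=
    continuous_schattenPow hr0.le (continuous_matrix fun a b => (hBc b.1).matrix_elem a b.2)
  have cv : Continuous fun x : σ → ℝ => schattenPow r (vstack fun i => B i x) :=
    continuous_schattenPow hr0.le (continuous_matrix fun a b => (hBc a.1).matrix_elem a.2 b)
  simp only [e1, e2, trace_cfc_dilation hr0, trace_cfc_dilation_mul_self hr0] at main
  rw [integral_add (integrable_pi_of_continuous hL ch) (integrable_pi_of_continuous hL cv)] at main
  simp only [← Finset.mul_sum, ← schattenPow_dstack, integral_const_mul] at main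
  -- Dilation doubles the left side and the diagonal term but not the two stacks; nonnegativity lets
  -- the resulting factor one half be dropped.
  have n1 : 0 ≤ ∫ x, schattenPow r (hstack fun i => B i x) ∂(Measure.pi fun _ : σ => ν) :=
    integral_nonneg fun x => schattenPow_nonneg _ _
  have n2 : 0 ≤ ∫ x, schattenPow r (vstack fun i => B i x) ∂(Measure.pi fun _ : σ => ν) :=
    integral_nonneg fun x => schattenPow_nonneg _ _
  have k : 0 ≤ (6 * r) ^ (2 * r) := by positivity
  have k1 := mul_nonneg k n1
  have k2 := mul_nonneg k n2
  linarith

end SchattenPow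

/-! ### Coloured parts and iteration of the Rosenthal inequality -/

section Colour

variable {n : ℕ}

/-- Evaluation at `x` of the part of the polynomial `P` of degree `m` whose monomials contain
exactly one variable of each of the colours `k, …, k + m - 1`; a monomial is found by its
derivative, and the derivatives are taken in the order of the colours. -/
def colourEval (c : Fin n → ℕ) (x : Fin n → ℝ) : ℕ → ℕ → MvPolynomial (Fin n) ℝ → ℝ
  | _, 0, P => MvPolynomial.constantCoeff P
  | k, m + 1, P =>
      ∑ j, (if c j = k then x j else 0) * colourEval c x (k + 1) m (MvPolynomial.pderiv j P)

theorem colourEval_zero (c : Fin n → ℕ) (x : Fin n → ℝ) (k m : ℕ) : colourEval c x k m 0 = 0 := by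
  induction m generalizing k with
  | zero => simp [colourEval]
  | succ m ih => simp [colourEval, ih]

/-- Only variables of colour at least `k` are still read. This independence makes the blocks in the
Rosenthal step adapted. -/
theorem colourEval_update (c : Fin n → ℕ) (x : Fin n → ℝ) {k : ℕ} (m : ℕ)
    (P : MvPolynomial (Fin n) ℝ) {i : Fin n} (hi : c i < k) (y : ℝ) :
    colourEval c (Function.update x i y) k m P = colourEval c x k m P := by
  induction m generalizing k P with
  | zero => rfl
  | succ m ih =>
    refine Finset.sum_congr rfl fun j _ => ?_
    rw [ih _ (by omega)]
    by_cases hj : c j = k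
    · rw [Function.update_of_ne (by rintro rfl; omega)]
    · simp [hj]

theorem continuous_colourEval (c : Fin n → ℕ) (k m : ℕ) (P : MvPolynomial (Fin n) ℝ) :
    Continuous fun x => colourEval c x k m P := by
  induction m generalizing k P with
  | zero => exact continuous_const
  | succ m ih =>
    simp only [colourEval]
    refine continuous_finsetSum _ fun j _ => Continuous.mul ?_ (ih _ _)
    by_cases hj : c j = k
    · simpa [hj] using continuous_apply j
    · simpa [hj] using continuous_const

variable {ν : Measure ℝ} [IsProbabilityMeasure ν] {L : ℝ} {α β : Type*} [Fintype α] [Fintype β]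
  [DecidableEq β]

/-- Conditioning on the colours one after the other. -/
theorem integral_schattenPow_colourEval_le (hL : ∀ᵐ y ∂ν, |y| ≤ L) (h1 : ∫ y, y ∂ν = 0)
    (h2 : ∫ y, y ^ 2 ∂ν = 1) {r : ℝ} (hr : 3 ≤ r) (F : PolyMatrix n α β) (col : Fin n → ℕ) (d : ℕ)
    {R : ℝ} (hR : ∀ {a b c : ℕ} (w : IncrementOrder a b c), a + b + c = d →
      ((L ^ 2) ^ r) ^ c * schattenPow r (constBlock F w) ≤ R)
    (m k : ℕ) {a b c : ℕ} (w : IncrementOrder a b c) (hd : a + b + c + m = d)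
    {ρ : w.Row n α → ℝ} {κ : w.Col n β → ℝ} (hρ : ∀ u, |ρ u| ≤ 1) (hκ : ∀ v, |κ v| ≤ 1) :
    ((L ^ 2) ^ r) ^ c * ∫ x, schattenPow r (Matrix.of fun u v =>
        ρ u * κ v * colourEval col x k m (derivBlock F w u v)) ∂(Measure.pi fun _ : Fin n => ν)
      ≤ (3 * (6 * r) ^ (2 * r)) ^ m * R := by
  classical
  have hl : 0 ≤ (L ^ 2) ^ r := by positivity
  induction m generalizing k a b c w with
  | zero =>
    -- No colour is left: the matrix is `constBlock F w` with rows and columns scaled by the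
    -- accumulated masks.
    have h := schattenPow_scale_le (r := r) (by linarith) (constBlock F w) hρ hκ
    simp only [colourEval, integral_const, probReal_univ, one_smul, pow_zero, one_mul]
    exact (mul_le_mul_of_nonneg_left h (pow_nonneg hl c)).trans (hR w (by simpa using hd))
  | succ m ih =>
    -- `B j` is the coefficient of `x j` when colour `k` is peeled off: it vanishes for the wrong
    -- colour and otherwise depends only on colours above `k`.
    set B : Fin n → (Fin n → ℝ) → Matrix (w.Row n α) (w.Col n β) ℝ := fun j x =>
      Matrix.of fun u v => if col j = k then ρ u * κ v *
        colourEval col x (k + 1) m (MvPolynomial.pderiv j (derivBlock F w u v)) else 0 with hB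
    have hBc : ∀ j, Continuous (B j) := fun j => continuous_matrix fun u v => by
      by_cases hj : col j = k
      · simp only [hB, hj, of_apply, if_true]
        exact continuous_const.mul (continuous_colourEval col (k + 1) m _)
      · simpa [hB, hj] using continuous_const
    have hadapt : Adapted B := fun i => by
      by_cases hi : col i = k
      · refine Or.inr fun j x y => ?_
        ext u v
        simp only [hB, of_apply]
        rw [colourEval_update _ _ _ _ (by omega)]
      · exact Or.inl fun x => by ext u v; simp [hB, hi]
    have hM : ∀ x : Fin n → ℝ, (Matrix.of fun u v =>
        ρ u * κ v * colourEval col x k (m + 1) (derivBlock F w u v)) = ∑ j, x j • B j x :=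
      fun x => by
        ext u v
        simp only [of_apply, colourEval, Matrix.sum_apply, Matrix.smul_apply, hB, smul_eq_mul,
          Finset.mul_sum]
        refine Finset.sum_congr rfl fun j _ => ?_
        split_ifs <;> ring
    simp only [hM]
    have main := integral_schattenPow_sum_smul_le hL h1 h2 hBc hadapt hr
    -- The colour condition on the new block index is moved into the row or column scaling, so each
    -- stack is again a scaled derivative block to which the induction hypothesis applies.
    have bound : ∀ {u : ℝ} (j : Fin n), |u| ≤ 1 → |u * if col j = k then 1 else 0| ≤ 1 :=
      fun j hu => by split_ifs <;> simp [hu]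
    have iv : ((L ^ 2) ^ r) ^ c * ∫ x, schattenPow r (vstack fun j => B j x)
        ∂(Measure.pi fun _ : Fin n => ν) ≤ (3 * (6 * r) ^ (2 * r)) ^ m * R := by
      refine le_trans (le_of_eq ?_) (ih (k + 1) w.vert (by omega)
        (ρ := fun u : Fin n × w.Row n α => ρ u.2 * if col u.1 = k then 1 else 0) (κ := κ)
        (fun u => bound _ (hρ _)) hκ)
      refine congrArg _ (integral_congr_ae (ae_of_all _ fun x => ?_))
      refine congrArg (schattenPow r) ?_
      ext ⟨j, u⟩ v
      change (if col j = k then _ else _) = ρ u * (if col j = k then 1 else 0) * κ v *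
        colourEval col x (k + 1) m (MvPolynomial.pderiv j (derivBlock F w u v))
      split_ifs <;> ring
    have ihz : ((L ^ 2) ^ r) ^ c * ∫ x, schattenPow r (hstack fun j => B j x)
        ∂(Measure.pi fun _ : Fin n => ν) ≤ (3 * (6 * r) ^ (2 * r)) ^ m * R := by
      refine le_trans (le_of_eq ?_) (ih (k + 1) w.horiz (by omega) (ρ := ρ)
        (κ := fun v : Fin n × w.Col n β => κ v.2 * if col v.1 = k then 1 else 0)
        hρ (fun v => bound _ (hκ _)))
      refine congrArg _ (integral_congr_ae (ae_of_all _ fun x => ?_))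
      refine congrArg (schattenPow r) ?_
      ext u ⟨j, v⟩
      change (if col j = k then _ else _) = ρ u * (κ v * (if col j = k then 1 else 0)) *
        colourEval col x (k + 1) m (MvPolynomial.pderiv j (derivBlock F w u v))
      split_ifs <;> ring
    -- The weight `(L ^ 2) ^ r` of the diagonal term is exactly what raises the exponent from `c` to
    -- `c + 1`.
    have idg : ((L ^ 2) ^ r) ^ (c + 1) * ∫ x, schattenPow r (dstack fun j => B j x)
        ∂(Measure.pi fun _ : Fin n => ν) ≤ (3 * (6 * r) ^ (2 * r)) ^ m * R := by
      refine le_trans (le_of_eq ?_) (ih (k + 1) w.diag (by omega)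
        (ρ := fun u : Fin n × w.Row n α => ρ u.2 * if col u.1 = k then 1 else 0)
        (κ := fun v : Fin n × w.Col n β => κ v.2) (fun u => bound _ (hρ _)) (fun v => hκ _))
      refine congrArg _ (integral_congr_ae (ae_of_all _ fun x => ?_))
      refine congrArg (schattenPow r) ?_
      ext ⟨j, u⟩ ⟨j', v⟩
      change (if j = j' then (if col j = k then _ else _) else 0)
        = ρ u * (if col j = k then 1 else 0) * κ v * colourEval col x (k + 1) m
          (if j = j' then MvPolynomial.pderiv j (derivBlock F w u v) else 0)
      by_cases hj : j = j'
      · simp only [hj, if_true]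
        split_ifs <;> ring
      · simp only [hj, if_false, colourEval_zero, mul_zero]
    have hK : 0 ≤ (6 * r) ^ (2 * r) := by positivity
    refine (mul_le_mul_of_nonneg_left main (pow_nonneg hl c)).trans ?_
    have tot := mul_le_mul_of_nonneg_left (add_le_add (add_le_add iv ihz) idg) hK
    refine le_trans (le_of_eq ?_) (tot.trans (le_of_eq ?_))
    · ring
    · ring

end Colour

/-! ### Independence of the order in which indices are raised -/

section Order

variable {n : ℕ}

/-- The commutator of two derivations is a derivation, and this one kills every variable. -/
theorem pderiv_comm {σ R : Type*} [CommRing R] (i j : σ) (P : MvPolynomial σ R) :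
    MvPolynomial.pderiv i (MvPolynomial.pderiv j P)
      = MvPolynomial.pderiv j (MvPolynomial.pderiv i P) := by
  classical
  have h : ⁅(MvPolynomial.pderiv i : Derivation R (MvPolynomial σ R) (MvPolynomial σ R)),
      (MvPolynomial.pderiv j : Derivation R (MvPolynomial σ R) (MvPolynomial σ R))⁆ = 0 := by
    refine MvPolynomial.derivation_ext fun k => ?_
    rw [Derivation.commutator_apply]
    simp only [MvPolynomial.pderiv_X, Pi.single_apply]
    split_ifs <;> simp
  have h2 := congrArg (fun D => D P) h
  simpa [Derivation.commutator_apply, sub_eq_zero] using h2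

/-- Iterated partial derivatives. -/
def iterPderiv : {m : ℕ} → (Fin m → Fin n) → MvPolynomial (Fin n) ℝ → MvPolynomial (Fin n) ℝ
  | 0, _, P => P
  | _ + 1, i, P => MvPolynomial.pderiv (i 0) (iterPderiv (Fin.tail i) P)

theorem pderiv_iterPderiv {m : ℕ} (i : Fin m → Fin n) (j : Fin n) (P : MvPolynomial (Fin n) ℝ) :
    MvPolynomial.pderiv j (iterPderiv i P) = iterPderiv i (MvPolynomial.pderiv j P) := by
  induction m with
  | zero => rfl
  | succ m ih => rw [iterPderiv, pderiv_comm, ih]; rfl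

theorem iterPderiv_cons {m : ℕ} (i : Fin m → Fin n) (j : Fin n) (P : MvPolynomial (Fin n) ℝ) :
    iterPderiv (Fin.cons j i : Fin (m + 1) → Fin n) P = MvPolynomial.pderiv j (iterPderiv i P) :=
  rfl

/-- The block matrix of derivatives with all vertical, all horizontal and all diagonal indices
grouped together. -/
def groupedBlock {α β : Type*} (F : PolyMatrix n α β) (a b c : ℕ) :
    PolyMatrix n ((Fin a → Fin n) × (Fin c → Fin n) × α)
      ((Fin b → Fin n) × (Fin c → Fin n) × β) :=
  Matrix.of fun u v => if u.2.1 = v.2.1 then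
    iterPderiv u.1 (iterPderiv v.1 (iterPderiv u.2.1 (F u.2.2 v.2.2))) else 0

/-- Prepending an index to a tuple. -/
def prependEquiv (n m : ℕ) (γ : Type*) :
    Fin n × (Fin m → Fin n) × γ ≃ (Fin (m + 1) → Fin n) × γ :=
  (Equiv.prodAssoc _ _ _).symm.trans
    ((Fin.consEquiv fun _ : Fin (m + 1) => Fin n).prodCongr (Equiv.refl γ))

/-- Prepending an index to the second of two tuples. -/
def prependSndEquiv (n l m : ℕ) (γ : Type*) :
    Fin n × (Fin l → Fin n) × (Fin m → Fin n) × γ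
      ≃ (Fin l → Fin n) × (Fin (m + 1) → Fin n) × γ :=
  ((Equiv.prodAssoc _ _ _).symm.trans
    ((Equiv.prodComm _ _).prodCongr (Equiv.refl _))).trans
      ((Equiv.prodAssoc _ _ _).trans ((Equiv.refl _).prodCongr (prependEquiv n m γ)))

/-- Grouping of the row indices. -/
def rowEquiv (α : Type*) : {a b c : ℕ} → (w : IncrementOrder a b c) →
    w.Row n α ≃ (Fin a → Fin n) × (Fin c → Fin n) × α
  | _, _, _, .nil => ((Equiv.uniqueProd _ _).trans (Equiv.uniqueProd _ _)).symm
  | _, _, _, .vert w => ((Equiv.refl (Fin n)).prodCongr (rowEquiv α w)).trans (prependEquiv _ _ _)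
  | _, _, _, .horiz w => rowEquiv α w
  | _, _, _, .diag w =>
    ((Equiv.refl (Fin n)).prodCongr (rowEquiv α w)).trans (prependSndEquiv _ _ _ _)

/-- Grouping of the column indices. -/
def colEquiv (β : Type*) : {a b c : ℕ} → (w : IncrementOrder a b c) →
    w.Col n β ≃ (Fin b → Fin n) × (Fin c → Fin n) × β
  | _, _, _, .nil => ((Equiv.uniqueProd _ _).trans (Equiv.uniqueProd _ _)).symm
  | _, _, _, .vert w => colEquiv β w
  | _, _, _, .horiz w => ((Equiv.refl (Fin n)).prodCongr (colEquiv β w)).trans (prependEquiv _ _ _)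
  | _, _, _, .diag w =>
    ((Equiv.refl (Fin n)).prodCongr (colEquiv β w)).trans (prependSndEquiv _ _ _ _)

/-- The right side depends on the order only through bijections of rows and columns, which leave
Schatten norms unchanged. -/
theorem derivBlock_apply {α β : Type*} (F : PolyMatrix n α β) {a b c : ℕ}
    (w : IncrementOrder a b c) (u : w.Row n α) (v : w.Col n β) :
    derivBlock F w u v = groupedBlock F a b c (rowEquiv α w u) (colEquiv β w v) := by
  induction w with
  | nil => rfl
  | vert w ih =>
    obtain ⟨j, u⟩ := u
    refine (congrArg (MvPolynomial.pderiv j) (ih u v)).trans ?_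
    simp only [groupedBlock, of_apply]
    rw [apply_ite (MvPolynomial.pderiv j), map_zero]
    rfl
  | horiz w ih =>
    obtain ⟨j, v⟩ := v
    refine (congrArg (MvPolynomial.pderiv j) (ih u v)).trans ?_
    simp only [groupedBlock, of_apply]
    rw [apply_ite (MvPolynomial.pderiv j), map_zero, pderiv_iterPderiv]
    rfl
  | diag w ih =>
    obtain ⟨j, u⟩ := u
    obtain ⟨j', v⟩ := v
    change (if j = j' then MvPolynomial.pderiv j (derivBlock F w u v) else 0)
      = if (Fin.cons j (rowEquiv α w u).2.1 : Fin (_ + 1) → Fin n)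
          = Fin.cons j' (colEquiv β w v).2.1
        then iterPderiv (rowEquiv α w u).1 (iterPderiv (colEquiv β w v).1
          (iterPderiv (Fin.cons j (rowEquiv α w u).2.1 : Fin (_ + 1) → Fin n)
            (F (rowEquiv α w u).2.2 (colEquiv β w v).2.2))) else 0
    rw [ih]
    simp only [groupedBlock, of_apply, Fin.cons_inj, iterPderiv_cons]
    by_cases hj : j = j'
    · by_cases hc : (rowEquiv α w u).2.1 = (colEquiv β w v).2.1
      · simp only [hj, hc, and_self, if_true, pderiv_iterPderiv]
      · simp [hj, hc]
    · simp [hj]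

/-- The Schatten norms of the matrices `F_{a,b,c}` do not depend on the order in which the indices
are raised. -/
theorem schattenPow_constBlock_eq {α β : Type*} [Fintype α] [Fintype β] [DecidableEq β] (r : ℝ)
    (F : PolyMatrix n α β) {a b c : ℕ} (w w' : IncrementOrder a b c) :
    schattenPow r (constBlock F w) = schattenPow r (constBlock F w') := by
  have key : ∀ w : IncrementOrder a b c, schattenPow r (constBlock F w)
      = schattenPow r ((groupedBlock F a b c).map MvPolynomial.constantCoeff) := fun w => by
    rw [← schattenPow_submatrix r ((groupedBlock F a b c).map MvPolynomial.constantCoeff)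
      (rowEquiv α w) (colEquiv β w)]
    refine congrArg _ ?_
    ext u v
    exact congrArg MvPolynomial.constantCoeff (derivBlock_apply F w u v)
  rw [key w, key w']

end Order

/-! ### Averaging over colourings -/

section Colouring

variable {n : ℕ}

theorem pderiv_prod_X {σ R : Type*} [DecidableEq σ] [CommRing R] (j : σ) (S : Finset σ) :
    MvPolynomial.pderiv j (∏ l ∈ S, (MvPolynomial.X l : MvPolynomial σ R))
      = if j ∈ S then ∏ l ∈ S.erase j, MvPolynomial.X l else 0 := by
  have h0 : ∀ S : Finset σ, j ∉ S →
      MvPolynomial.pderiv j (∏ l ∈ S, (MvPolynomial.X l : MvPolynomial σ R)) = 0 := fun S => by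
    induction S using Finset.induction_on with
    | empty => simp
    | insert a S ha ih =>
      intro hj
      rw [Finset.mem_insert, not_or] at hj
      rw [Finset.prod_insert ha, MvPolynomial.pderiv_mul, ih hj.2,
        MvPolynomial.pderiv_X_of_ne (Ne.symm hj.1)]
      simp
  split_ifs with h
  · rw [← Finset.mul_prod_erase S _ h, MvPolynomial.pderiv_mul, h0 _ (Finset.notMem_erase j S)]
    simp
  · exact h0 S h

theorem colourEval_add (c : Fin n → ℕ) (x : Fin n → ℝ) (k m : ℕ) (P Q : MvPolynomial (Fin n) ℝ) :
    colourEval c x k m (P + Q) = colourEval c x k m P + colourEval c x k m Q := by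
  induction m generalizing k P Q with
  | zero => simp [colourEval]
  | succ m ih => simp [colourEval, ih, mul_add, Finset.sum_add_distrib]

theorem colourEval_C_mul (c : Fin n → ℕ) (x : Fin n → ℝ) (k m : ℕ) (t : ℝ)
    (P : MvPolynomial (Fin n) ℝ) :
    colourEval c x k m (MvPolynomial.C t * P) = t * colourEval c x k m P := by
  induction m generalizing k P with
  | zero => simp [colourEval]
  | succ m ih =>
    simp only [colourEval, MvPolynomial.pderiv_C_mul, ih, Finset.mul_sum]
    exact Finset.sum_congr rfl fun _ _ => by ring

theorem colourEval_sum (c : Fin n → ℕ) (x : Fin n → ℝ) (k m : ℕ) {κ : Type*} (s : Finset κ)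
    (P : κ → MvPolynomial (Fin n) ℝ) :
    colourEval c x k m (∑ i ∈ s, P i) = ∑ i ∈ s, colourEval c x k m (P i) := by
  classical
  induction s using Finset.induction_on with
  | empty => simp [colourEval_zero]
  | insert a s ha ih => rw [Finset.sum_insert ha, Finset.sum_insert ha, colourEval_add, ih]

/-- A squarefree monomial survives exactly when its variables carry the `m` colours bijectively. The
colours then fix the order of differentiation, so it is counted once and not `m!` times. -/
theorem colourEval_prod_X (c : Fin n → ℕ) (x : Fin n → ℝ) (m k : ℕ) (S : Finset (Fin n))
    (hS : S.card = m) :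
    colourEval c x k m (∏ l ∈ S, MvPolynomial.X l)
      = if S.image c = Finset.Ico k (k + m) then ∏ l ∈ S, x l else 0 := by
  induction m generalizing k S with
  | zero =>
    rw [Finset.card_eq_zero] at hS
    simp [colourEval, hS]
  | succ m ih =>
    simp only [colourEval, pderiv_prod_X]
    have hterm : ∀ j, (if c j = k then x j else 0) * colourEval c x (k + 1) m
          (if j ∈ S then ∏ l ∈ S.erase j, MvPolynomial.X l else 0)
        = if c j = k ∧ j ∈ S ∧ (S.erase j).image c = Finset.Ico (k + 1) (k + 1 + m)
          then ∏ l ∈ S, x l else 0 := fun j => by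
      by_cases hj : j ∈ S
      · rw [if_pos hj, ih (k + 1) _ (by rw [Finset.card_erase_of_mem hj, hS]; rfl),
          ← Finset.mul_prod_erase S _ hj]
        by_cases h1 : c j = k <;>
          by_cases h2 : (S.erase j).image c = Finset.Ico (k + 1) (k + 1 + m) <;> simp [h1, h2, hj]
      · simp [hj, colourEval_zero]
    simp only [hterm]
    have hIco : insert k (Finset.Ico (k + 1) (k + 1 + m)) = Finset.Ico k (k + (m + 1)) := by
      ext i; simp only [Finset.mem_insert, Finset.mem_Ico]; omega
    split_ifs with h
    · have hinj : Set.InjOn c S := Finset.injOn_of_card_image_eq (by rw [h, hS]; simp)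
      obtain ⟨j, hj, hjk⟩ := Finset.mem_image.mp
        (h ▸ Finset.mem_Ico.mpr ⟨le_rfl, by omega⟩ : k ∈ S.image c)
      have he : (S.erase j).image c = Finset.Ico (k + 1) (k + 1 + m) := by
        ext i
        constructor
        · intro hi
          obtain ⟨l, hl, rfl⟩ := Finset.mem_image.mp hi
          rw [Finset.mem_erase] at hl
          have h1 : c l ∈ Finset.Ico k (k + (m + 1)) := h ▸ Finset.mem_image_of_mem c hl.2
          have h2 : c l ≠ k := fun e => hl.1 (hinj hl.2 hj (e.trans hjk.symm))
          rw [Finset.mem_Ico] at h1 ⊢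
          omega
        · intro hi
          have h1 : i ∈ S.image c := by
            rw [h, ← hIco]; exact Finset.mem_insert_of_mem hi
          obtain ⟨l, hl, rfl⟩ := Finset.mem_image.mp h1
          refine Finset.mem_image_of_mem c (Finset.mem_erase.mpr ⟨?_, hl⟩)
          rintro rfl
          rw [Finset.mem_Ico] at hi
          omega
      rw [Finset.sum_eq_single j, if_pos ⟨hjk, hj, he⟩]
      · intro l _ hl
        rw [if_neg]
        rintro ⟨h1, h2, _⟩
        exact hl (hinj h2 hj (h1.trans hjk.symm))
      · simp
    · refine Finset.sum_eq_zero fun j _ => if_neg ?_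
      rintro ⟨h1, h2, h3⟩
      apply h
      rw [← Finset.insert_erase h2, Finset.image_insert, h3, h1, hIco]

/-- The number of surjective self-maps of `Fin d`. -/
def surjCount (d : ℕ) : ℕ := Fintype.card {g : Fin d → Fin d // Function.Surjective g}

theorem surjCount_pos (d : ℕ) : 0 < surjCount d :=
  Fintype.card_pos_iff.mpr ⟨⟨id, Function.surjective_id⟩⟩

/-- A good colouring is a surjection of `S` onto the colours together with an arbitrary colouring of
the complement. The count does not depend on `S`, which is why averaging recovers a multiple of `F`.
-/
theorem card_colourings {d : ℕ} (S : Finset (Fin n)) (hS : S.card = d) :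
    ((Finset.univ : Finset (Fin n → Fin d)).filter fun c =>
      S.image (fun j => (c j : ℕ)) = Finset.Ico 0 (0 + d)).card = surjCount d * d ^ (n - d) := by
  let e : S ≃ Fin d := S.equivFinOfCardEq hS
  have h : ∀ c : Fin n → Fin d, S.image (fun j => (c j : ℕ)) = Finset.Ico 0 (0 + d) ↔
      Function.Surjective fun s : {j // j ∈ S} => c s := fun c => by
    constructor
    · intro h i
      have hi : (i : ℕ) ∈ S.image (fun j => (c j : ℕ)) := by
        rw [h]; simp
      obtain ⟨j, hj, hji⟩ := Finset.mem_image.mp hi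
      exact ⟨⟨j, hj⟩, Fin.ext hji⟩
    · intro h
      ext i
      simp only [Finset.mem_image, Finset.mem_Ico, zero_add, Nat.zero_le, true_and]
      constructor
      · rintro ⟨j, _, rfl⟩; exact (c j).2
      · intro hi
        obtain ⟨j, hj⟩ := h ⟨i, hi⟩
        exact ⟨j, j.2, congrArg Fin.val hj⟩
  rw [← Fintype.card_subtype]
  have e1 : {c : Fin n → Fin d // S.image (fun j => (c j : ℕ)) = Finset.Ico 0 (0 + d)}
      ≃ {p : ({j // j ∈ S} → Fin d) × ({j // j ∉ S} → Fin d) // Function.Surjective p.1} :=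
    (Equiv.piEquivPiSubtypeProd (fun j => j ∈ S) fun _ => Fin d).subtypeEquiv h
  have e2 : {f : {j // j ∈ S} → Fin d // Function.Surjective f}
      ≃ {g : Fin d → Fin d // Function.Surjective g} :=
    (e.arrowCongr (Equiv.refl _)).subtypeEquiv fun f => by simp [Equiv.arrowCongr]
  rw [Fintype.card_congr (e1.trans (Equiv.prodSubtypeFstEquivSubtypeProd.trans
    (e2.prodCongr (Equiv.refl _)))), Fintype.card_prod, Fintype.card_fun, Fintype.card_fin,
    Fintype.card_subtype_compl, Fintype.card_coe, hS, Fintype.card_fin]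
  rfl

theorem sum_colourEval_multilinearPoly {d : ℕ} {α β : Type*} (A : (Fin d ↪ Fin n) → Matrix α β ℝ)
    (x : Fin n → ℝ) (u : α) (v : β) :
    ∑ c : Fin n → Fin d, colourEval (fun j => (c j : ℕ)) x 0 d (multilinearPoly A u v)
      = (surjCount d * d ^ (n - d) : ℕ) * evalAt (multilinearPoly A) x u v := by
  have hprod : ∀ i : Fin d ↪ Fin n, (∏ k, (MvPolynomial.X (i k) : MvPolynomial (Fin n) ℝ))
      = ∏ l ∈ Finset.univ.map i, MvPolynomial.X l := fun i => by rw [Finset.prod_map]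
  simp only [multilinearPoly, evalAt, Matrix.map_apply, of_apply, map_sum, map_mul,
    MvPolynomial.eval_C, hprod, colourEval_sum, colourEval_C_mul]
  rw [Finset.sum_comm, Finset.mul_sum]
  refine Finset.sum_congr rfl fun i _ => ?_
  have hc : (Finset.univ.map i).card = d := by simp
  simp only [colourEval_prod_X _ x d 0 _ hc]
  rw [← Finset.mul_sum, ← Finset.sum_filter, Finset.sum_const, card_colourings _ hc, nsmul_eq_mul,
    map_prod]
  simp only [MvPolynomial.eval_X]
  ring

end Colouring

/-! ### The moment bound under the product measure -/

section Main

variable {n d : ℕ} {ν : Measure ℝ} [IsProbabilityMeasure ν] {L : ℝ} {α β : Type*}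

theorem continuous_evalAt (F : PolyMatrix n α β) : Continuous fun x => evalAt F x :=
  continuous_matrix fun u v => MvPolynomial.continuous_eval (F u v)

theorem evalAt_multilinearPoly (A : (Fin d ↪ Fin n) → Matrix α β ℝ) (x : Fin n → ℝ) (u : α)
    (v : β) : evalAt (multilinearPoly A) x u v = ∑ i, A i u v * ∏ k, x (i k) := by
  simp [evalAt, multilinearPoly]

theorem integral_evalAt_multilinearPoly (hL : ∀ᵐ y ∂ν, |y| ≤ L) (h1 : ∫ y, y ∂ν = 0)
    (hd : d ≠ 0) (A : (Fin d ↪ Fin n) → Matrix α β ℝ) (u : α) (v : β) :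
    ∫ x, evalAt (multilinearPoly A) x u v ∂(Measure.pi fun _ : Fin n => ν) = 0 := by
  obtain ⟨m, rfl⟩ := Nat.exists_eq_succ_of_ne_zero hd
  simp only [evalAt_multilinearPoly]
  rw [integral_finsetSum _ fun i _ => integrable_pi_of_continuous hL (by fun_prop)]
  refine Finset.sum_eq_zero fun i _ => ?_
  -- The entries of `i` are distinct, so the monomial is linear in the variable `x (i 0)`, which has
  -- mean zero.
  rw [integral_pi_eq_integral_update hL (i 0) (by fun_prop)]
  have : ∀ (x : Fin n → ℝ) (y : ℝ), A i u v * ∏ k, Function.update x (i 0) y (i k)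
      = (A i u v * ∏ k : Fin m, x (i k.succ)) * y := fun x y => by
    have h : ∀ k : Fin m, Function.update x (i 0) y (i k.succ) = x (i k.succ) := fun k =>
      Function.update_of_ne (i.injective.ne (Fin.succ_ne_zero k)) _ _
    rw [Fin.prod_univ_succ]
    simp only [h, Function.update_self]
    ring
  have h0 : ∀ x : Fin n → ℝ, ∫ y, A i u v * ∏ k, Function.update x (i 0) y (i k) ∂ν = 0 :=
    fun x => by
      simp only [this]
      rw [integral_const_mul, h1, mul_zero]
  simp only [h0, integral_zero]

theorem derivBlock_zero {a b c : ℕ} (w : IncrementOrder a b c) :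
    derivBlock (0 : PolyMatrix n α β) w = 0 := by
  induction w with
  | nil => rfl
  | vert w ih =>
    ext1 u v
    exact (congrArg (MvPolynomial.pderiv u.1) (congrFun (congrFun ih u.2) v)).trans (map_zero _)
  | horiz w ih =>
    ext1 u v
    exact (congrArg (MvPolynomial.pderiv v.1) (congrFun (congrFun ih u) v.2)).trans (map_zero _)
  | diag w ih =>
    ext1 u v
    change (if u.1 = v.1 then MvPolynomial.pderiv u.1 (derivBlock 0 w u.2 v.2) else 0) = 0
    rw [ih]
    simp

theorem constBlock_zero {a b c : ℕ} (w : IncrementOrder a b c) :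
    constBlock (0 : PolyMatrix n α β) w = 0 := by
  ext1 u v
  simp [constBlock, derivBlock_zero]

theorem multilinearPoly_eq_zero_of_lt (h : n < d) (A : (Fin d ↪ Fin n) → Matrix α β ℝ) :
    multilinearPoly A = 0 := by
  have : IsEmpty (Fin d ↪ Fin n) := ⟨fun i => by
    have := Fintype.card_le_of_embedding i
    simp at this
    omega⟩
  ext1 u v
  simp [multilinearPoly]

variable [Fintype α] [Fintype β] [DecidableEq β]

/-- Averaging over all colourings of the variables by `d` colours. -/
theorem schattenPow_evalAt_le {r : ℝ} (hr : 1 ≤ r) (hd : d ≠ 0) (hdn : d ≤ n)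
    (A : (Fin d ↪ Fin n) → Matrix α β ℝ) (x : Fin n → ℝ) :
    schattenPow r (evalAt (multilinearPoly A) x)
      ≤ (((d : ℝ) ^ d) ^ 2) ^ r * ((Fintype.card (Fin n → Fin d) : ℝ)⁻¹ *
        ∑ c : Fin n → Fin d, schattenPow r (Matrix.of fun u v =>
          colourEval (fun j => (c j : ℕ)) x 0 d (multilinearPoly A u v))) := by
  classical
  have : Nonempty (Fin d) := ⟨⟨0, Nat.pos_of_ne_zero hd⟩⟩
  have hd0 : (d : ℝ) ≠ 0 := by exact_mod_cast hd
  have hq : (1 : ℝ) ≤ surjCount d := by exact_mod_cast surjCount_pos d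
  have hq0 : (surjCount d : ℝ) ≠ 0 := by linarith
  have heq : evalAt (multilinearPoly A) x = ((d : ℝ) ^ d / surjCount d) •
      ((Fintype.card (Fin n → Fin d) : ℝ)⁻¹ • ∑ c : Fin n → Fin d, Matrix.of fun u v =>
        colourEval (fun j => (c j : ℕ)) x 0 d (multilinearPoly A u v)) := by
    ext u v
    simp only [Matrix.smul_apply, Matrix.sum_apply, of_apply, smul_eq_mul,
      sum_colourEval_multilinearPoly, Fintype.card_fun, Fintype.card_fin]
    push_cast
    have hpow : (d : ℝ) ^ n = d ^ d * d ^ (n - d) := by rw [← pow_add]; congr 1; omega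
    rw [hpow]
    field_simp
  rw [heq, schattenPow_smul]
  refine mul_le_mul ?_ (schattenPow_average_le hr _) (schattenPow_nonneg _ _) (by positivity)
  refine Real.rpow_le_rpow (by positivity) ?_ (by linarith)
  gcongr
  -- The gain from `surjCount d` is discarded; only its positivity is used.
  exact div_le_self (by positivity) hq

theorem three_mul_rpow_pow_le {r : ℝ} (hr : 1 ≤ r) (d : ℕ) :
    (((d : ℝ) ^ d) ^ 2) ^ r * (3 * (6 * r) ^ (2 * r)) ^ d ≤ (24 * d * r) ^ (2 * d * r) := by
  -- Absorbing the three terms of each step into the base turns `6` into `24`.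
  have h3 : (3 : ℝ) ≤ 4 ^ (2 * r) := by
    calc (3 : ℝ) ≤ 4 ^ (1 : ℝ) := by norm_num
      _ ≤ 4 ^ (2 * r) := Real.rpow_le_rpow_of_exponent_le (by norm_num) (by linarith)
  have hd0 : (0 : ℝ) ≤ d := Nat.cast_nonneg d
  have e1 : (((d : ℝ) ^ d) ^ 2) ^ r = ((d : ℝ) ^ (2 * r)) ^ d := by
    rw [Real.rpow_mul hd0, Real.rpow_two, ← Real.rpow_natCast, ← Real.rpow_natCast _ d,
      ← Real.rpow_natCast _ d, ← Real.rpow_mul (by positivity), ← Real.rpow_natCast,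
      ← Real.rpow_mul (by positivity), ← Real.rpow_mul (by positivity),
      ← Real.rpow_mul (by positivity)]
    congr 1
    push_cast
    ring
  have e2 : (24 * d * r) ^ (2 * d * r) = ((d : ℝ) ^ (2 * r) * (4 ^ (2 * r) * (6 * r) ^ (2 * r))) ^ d := by
    rw [← Real.mul_rpow (by norm_num) (by linarith), ← Real.mul_rpow hd0 (by linarith),
      ← Real.rpow_natCast, ← Real.rpow_mul (by positivity)]
    congr 1 <;> ring
  rw [e1, e2, ← mul_pow]
  gcongr

theorem integral_schattenPow_evalAt_le (hL : ∀ᵐ y ∂ν, |y| ≤ L) (h1 : ∫ y, y ∂ν = 0)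
    (h2 : ∫ y, y ^ 2 ∂ν = 1) {r : ℝ} (hr : 3 ≤ r) (hd : d ≠ 0) (hdn : d ≤ n)
    (A : (Fin d ↪ Fin n) → Matrix α β ℝ) {R : ℝ}
    (hR : ∀ {a b c : ℕ} (w : IncrementOrder a b c), a + b + c = d →
      ((L ^ 2) ^ r) ^ c * schattenPow r (constBlock (multilinearPoly A) w) ≤ R) (hR0 : 0 ≤ R) :
    ∫ x, schattenPow r (evalAt (multilinearPoly A) x) ∂(Measure.pi fun _ : Fin n => ν)
      ≤ (24 * d * r) ^ (2 * d * r) * R := by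
  have : Nonempty (Fin d) := ⟨⟨0, Nat.pos_of_ne_zero hd⟩⟩
  set N : ℝ := ((Fintype.card (Fin n → Fin d) : ℕ) : ℝ) with hN
  have hN0 : 0 < N := by simp only [hN]; exact_mod_cast Fintype.card_pos
  have hcont : ∀ c : Fin n → Fin d, Continuous fun x => schattenPow r (Matrix.of fun u v =>
      colourEval (fun j => (c j : ℕ)) x 0 d (multilinearPoly A u v)) := fun c =>
    continuous_schattenPow (by linarith) (continuous_matrix fun u v => continuous_colourEval _ _ _ _)
  have hcol : ∀ c : Fin n → Fin d, ∫ x, schattenPow r (Matrix.of fun u v =>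
      colourEval (fun j => (c j : ℕ)) x 0 d (multilinearPoly A u v))
        ∂(Measure.pi fun _ : Fin n => ν) ≤ (3 * (6 * r) ^ (2 * r)) ^ d * R := fun c => by
    have h := integral_schattenPow_colourEval_le hL h1 h2 hr (multilinearPoly A)
      (fun j => (c j : ℕ)) d hR d 0 IncrementOrder.nil (by omega) (ρ := fun _ => 1)
      (κ := fun _ => 1) (by simp) (by simp)
    simp only [pow_zero, one_mul, mul_one] at h
    exact h
  calc ∫ x, schattenPow r (evalAt (multilinearPoly A) x) ∂(Measure.pi fun _ : Fin n => ν)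
      ≤ ∫ x, (((d : ℝ) ^ d) ^ 2) ^ r * (N⁻¹ *
        ∑ c : Fin n → Fin d, schattenPow r (Matrix.of fun u v =>
          colourEval (fun j => (c j : ℕ)) x 0 d (multilinearPoly A u v)))
        ∂(Measure.pi fun _ : Fin n => ν) := by
        refine integral_mono (integrable_pi_of_continuous hL
          (continuous_schattenPow (by linarith) (continuous_evalAt _)))
          (integrable_pi_of_continuous hL ?_)
          fun x => schattenPow_evalAt_le (by linarith) hd hdn A x
        exact continuous_const.mul (continuous_const.mul
          (continuous_finsetSum _ fun c _ => hcont c))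
    _ ≤ (((d : ℝ) ^ d) ^ 2) ^ r * (N⁻¹ * (N * ((3 * (6 * r) ^ (2 * r)) ^ d * R))) := by
        rw [integral_const_mul, integral_const_mul,
          integral_finsetSum _ fun c _ => integrable_pi_of_continuous hL (hcont c)]
        gcongr
        refine (Finset.sum_le_sum fun c _ => hcol c).trans_eq ?_
        rw [Finset.sum_const, Finset.card_univ, nsmul_eq_mul, hN]
    _ = (((d : ℝ) ^ d) ^ 2) ^ r * (3 * (6 * r) ^ (2 * r)) ^ d * R := by
        rw [inv_mul_cancel_left₀ hN0.ne', mul_assoc]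
    _ ≤ _ := mul_le_mul_of_nonneg_right (three_mul_rpow_pow_le (by linarith) d) hR0

end Main

end MatrixPoly

/-! ### Transfer to the given random variables -/

theorem mainTheorem1 {Ω : Type*} [MeasurableSpace Ω] (μ : Measure Ω) [IsProbabilityMeasure μ]
    (n d p q : ℕ) (L : ℝ) (x : Fin n → Ω → ℝ)
    (hindep : iIndepFun x μ)
    (hident : ∀ i j, IdentDistrib (x i) (x j) μ μ)
    (hmean : ∀ i, ∫ ω, x i ω ∂μ = 0)
    (hvar : ∀ i, ∫ ω, x i ω ^ 2 ∂μ = 1)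
    (hbound : ∀ i, ∀ᵐ ω ∂μ, |x i ω| ≤ L)
    (A : (Fin d ↪ Fin n) → Matrix (Fin p) (Fin q) ℝ)
    (hA : MatrixPoly.PermSymmetric A)
    (F : MatrixPoly.PolyMatrix n (Fin p) (Fin q))
    (hF : F = MatrixPoly.multilinearPoly A)
    (X : Ω → Matrix (Fin p) (Fin q) ℝ)
    (hX : X = fun ω => MatrixPoly.evalAt F (fun i => x i ω))
    (order : ∀ a b c : ℕ, MatrixPoly.IncrementOrder a b c)
    (t : ℝ) (ht : 2 ≤ t) :
    ∫ ω, MatrixPoly.schattenNorm (4 * t) (X ω - MatrixPoly.expectation μ X) ^ (4 * t) ∂μ ≤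
      ∑ k ∈ Finset.Nat.antidiagonalTuple 3 d,
        (48 * (d : ℝ) * t) ^ (4 * (d : ℝ) * t) * L ^ (4 * (k 2 : ℝ) * t) *
          MatrixPoly.schattenNorm (4 * t)
            (MatrixPoly.constBlock F (order (k 0) (k 1) (k 2))) ^ (4 * t) := by
  open MatrixPoly in
  have ht0 : 0 < t := by linarith
  have ht2 : 2 * t ≠ 0 := by positivity
  simp only [schattenNorm_rpow ht0]
  rcases lt_or_ge n d with hnd | hdn
  · have hF0 : F = 0 := hF.trans (multilinearPoly_eq_zero_of_lt hnd A)
    have hX0 : ∀ ω, X ω = 0 := fun ω => by ext u v; simp [hX, hF0, evalAt]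
    have hE : expectation μ X = 0 := by ext u v; simp [expectation, hX0]
    simp [hX0, hE, hF0, constBlock_zero, schattenPow_zero ht2]
  rcases Nat.eq_zero_or_pos d with rfl | hd
  · have hconst : ∀ ω, X ω = evalAt F 0 := fun ω => by
      ext u v
      simp [hX, hF, evalAt_multilinearPoly]
    have hE : expectation μ X = evalAt F 0 := by ext u v; simp [expectation, hconst]
    simp only [hconst, hE, sub_self, schattenPow_zero ht2, integral_zero]
    refine Finset.sum_nonneg fun k hk => ?_
    -- When `d = 0` there may be no variables at all, so the sign of `L` is unknown; its exponent is
    -- zero.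
    have hk2 : k 2 = 0 := by
      have := Finset.Nat.mem_antidiagonalTuple.mp hk
      rw [Fin.sum_univ_three] at this
      omega
    simp only [hk2, Nat.cast_zero, mul_zero, zero_mul, Real.rpow_zero, one_mul]
    exact schattenPow_nonneg _ _
  have hn : 0 < n := by omega
  set i0 : Fin n := ⟨0, hn⟩
  have hxm : ∀ i, AEMeasurable (x i) μ := fun i => (hident i i).aemeasurable_fst
  set ν : Measure ℝ := μ.map (x i0) with hν
  have : IsProbabilityMeasure ν := Measure.isProbabilityMeasure_map (hxm i0)
  have hlaw : μ.map (fun ω i => x i ω) = Measure.pi fun _ : Fin n => ν := by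
    rw [(iIndepFun_iff_map_fun_eq_pi_map hxm).mp hindep]
    exact congrArg _ (funext fun i => (hident i i0).map_eq)
  have hL : ∀ᵐ y ∂ν, |y| ≤ L := by
    rw [hν, ae_map_iff (hxm i0) (measurableSet_le (by fun_prop) (by fun_prop))]
    exact hbound i0
  have h1 : ∫ y, y ∂ν = 0 := by
    rw [hν, integral_map (hxm i0) (by fun_prop)]
    exact hmean i0
  have h2 : ∫ y, y ^ 2 ∂ν = 1 := by
    rw [hν, integral_map (hxm i0) (by fun_prop)]
    exact hvar i0
  have hxv : AEMeasurable (fun ω i => x i ω) μ := aemeasurable_pi_lambda _ hxm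
  have transfer : ∀ {g : (Fin n → ℝ) → ℝ}, Continuous g →
      ∫ ω, g (fun i => x i ω) ∂μ = ∫ y, g y ∂(Measure.pi fun _ : Fin n => ν) := fun hg => by
    rw [← hlaw, integral_map hxv hg.measurable.aestronglyMeasurable]
  have hL1 := one_le_of_integral_sq_eq_one hL h2
  have hE : expectation μ X = 0 := by
    ext u v
    simp only [expectation, Matrix.of_apply, hX, hF, Matrix.zero_apply]
    rw [transfer (g := fun y => evalAt (multilinearPoly A) y u v)
      ((continuous_evalAt _).matrix_elem u v)]
    exact integral_evalAt_multilinearPoly hL h1 hd.ne' A u v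
  simp only [hE, sub_zero]
  simp only [hX, hF]
  rw [transfer (g := fun y => schattenPow (2 * t) (evalAt (multilinearPoly A) y))
    (continuous_schattenPow (by linarith) (continuous_evalAt _))]
  have hLc : ∀ c : ℕ, ((L ^ 2) ^ (2 * t)) ^ c = L ^ (4 * (c : ℝ) * t) := fun c => by
    have hL0 : 0 ≤ L := by linarith
    rw [← Real.rpow_natCast _ c, ← Real.rpow_two, ← Real.rpow_mul hL0, ← Real.rpow_mul hL0]
    congr 1
    ring
  have hterm : ∀ k : Fin 3 → ℕ, 0 ≤ ((L ^ 2) ^ (2 * t)) ^ (k 2) * schattenPow (2 * t)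
      (constBlock (multilinearPoly A) (order (k 0) (k 1) (k 2))) := fun k =>
    mul_nonneg (by positivity) (schattenPow_nonneg _ _)
  -- The peeling meets every order of raising indices; each is exchanged for the prescribed one, and
  -- the whole sum serves as a common bound `R` for its terms.
  have main := integral_schattenPow_evalAt_le hL h1 h2 (r := 2 * t) (by linarith) hd.ne' hdn A
    (R := ∑ k ∈ Finset.Nat.antidiagonalTuple 3 d, ((L ^ 2) ^ (2 * t)) ^ (k 2) *
      schattenPow (2 * t) (constBlock (multilinearPoly A) (order (k 0) (k 1) (k 2))))
    (fun {a b c} w hw => by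
      rw [schattenPow_constBlock_eq _ _ w (order a b c)]
      have hk : ![a, b, c] ∈ Finset.Nat.antidiagonalTuple 3 d := by
        rw [Finset.Nat.mem_antidiagonalTuple, Fin.sum_univ_three]
        exact hw
      exact Finset.single_le_sum (f := fun k : Fin 3 → ℕ => ((L ^ 2) ^ (2 * t)) ^ (k 2) *
        schattenPow (2 * t) (constBlock (multilinearPoly A) (order (k 0) (k 1) (k 2))))
        (fun k _ => hterm k) hk)
    (Finset.sum_nonneg fun k _ => hterm k)
  refine main.trans_eq ?_
  rw [Finset.mul_sum]
  refine Finset.sum_congr rfl fun k _ => ?_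
  rw [hLc, ← mul_assoc]
  congr 3 <;> ring

end
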